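/- **Theorem.** Let $d\ge 3$ and $n\ge d+2$. Then the centrally symmetric, cs-$\lceil d/2\rceil$-neighborly simplicial $d$-sphere $\Delta^d_n$ of Novik and Zheng, on the $2n$ vertices $\pm1,\dots,\pm n$, is not realizable in $\mathbb{R}^{d+1}$ (as a convex $(d+1)$-polytope). Here a simplicial complex $K$ with vertex set $V$ is called *realizable* in $\mathbb{R}^{D}$ if there are points $x_v\in\mathbb{R}^{D}$ $(v\in V)$ such that for every face $\sigma$ of $K$ the set $\operatorname{conv}\{x_v: v\in\sigma\}$ is a face of $\operatorname{conv}\{x_v:v\in V\}$, in the sense that there is a hyperplane $H_\sigma=\{y:\langle a,y\rangle=b\}$ with $\operatorname{conv}\{x_v:v\in\sigma\}\subset H_\sigma$ and with $\operatorname{conv}\{x_v:v\in V\setminus\sigma\}$ lying strictly on one side of $H_\sigma$. (In particular, a complex that is the boundary complex of a simplicial convex $D$-polytope is realizable in $\mathbb{R}^D$.) The spheres $\Delta^d_n$ $(d\ge1,\ n\ge d+1)$ and the balls $B^{d,i}_n$ $(d\ge 1,\ 0\le i\le\lceil d/2\rceil,\ n\ge d+1)$ are the pure $d$-dimensional simplicial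 complexes defined recursively as follows. Write $K*v$ for the cone over $K$ with apex $v$, $-K$ for the image of $K$ under $v\mapsto -v$, $\partial B$ for the complex generated by the ridges of $B$ that lie in exactly one facet of $B$, and $K\setminus L$ for the complex generated by the facets of $K$ that are not facets of $L$. 1. $\Delta^d_{d+1}$ is the boundary complex of the $(d+1)$-dimensional cross-polytope with vertices $\pm1,\dots,\pm(d+1)$. 2. For $n\ge d+1$, $\Delta^d_{n+1}$ is obtained from $\Delta^d_n$ by replacing the ball $B=B^{d,\lceil d/2\rceil-1}_n$ by $\partial B*(n+1)$ and the ball $-B$ by $\partial(-B)*(-(n+1))$. 3. $B^{1,0}_n$ is the edge $\{-1,n\}$. 4. If $d=2k-1$ is odd, then $B^{d,k}_n=\Delta^{d}_n\setminus B^{d,k-1}_n$. 5. If $d\ge2$ and $d\ne 2i-1$, then $B^{d,i}_n=\bigl(B^{d-1,i}_{n-1}*n\bigr)\cup\bigl((-B^{d-1,i-1}_{n-1})*(-n)\bigr)$, where $B^{d-1,-1}_{n-1}=\emptyset$. -/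

import Mathlib

namespace NovikZheng

/-! A pure simplicial complex is given by the finite set of its facets. The vertices are the
integers `±1, …, ±n`, and the antipodal map is `v ↦ -v`. -/

/-- The cone with apex `v` (the join of a complex with the single vertex `v`). -/
def cone (F : Finset (Finset ℤ)) (v : ℤ) : Finset (Finset ℤ) :=
  F.image (fun σ => insert v σ)

/-- The antipodal image `-F` of a complex. -/
def antipode (F : Finset (Finset ℤ)) : Finset (Finset ℤ) :=
  F.image (fun σ => σ.image (fun v => -v))

/-- The facets of the boundary of a pure complex: the ridges that lie in exactly one facet. -/
def boundary (F : Finset (Finset ℤ)) : Finset (Finset ℤ) :=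
  (F.biUnion (fun σ => σ.image (fun v => σ.erase v))).filter
    (fun ρ => (F.filter (fun σ => ρ ⊆ σ)).card = 1)

/-- The boundary complex of the `m`-dimensional cross-polytope with vertices `±1, …, ±m`, as an
iterated suspension: a facet contains exactly one of `k` and `-k` for every `k` in `{1, …, m}`. -/
def crossPolytope : ℕ → Finset (Finset ℤ)
  | 0 => {∅}
  | m + 1 => cone (crossPolytope m) (m + 1 : ℤ) ∪ cone (crossPolytope m) (-(m + 1 : ℤ))

/-- Replace, in the complex `F`, the ball `B` by the cone over its boundary with the new vertex
`n`, and the ball `-B` by the cone over its boundary with the new vertex `-n`. -/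
def exchange (F B : Finset (Finset ℤ)) (n : ℕ) : Finset (Finset ℤ) :=
  (F \ (B ∪ antipode B)) ∪
    (cone (boundary B) (n : ℤ) ∪ cone (boundary (antipode B)) (-(n : ℤ)))

/-- Start with the boundary of the `(d + 1)`-dimensional cross-polytope and exchange `m` times:
the step that adds the vertices `±(n + 1)` replaces the balls `±(B n)`. The result has vertices
`±1, …, ±(d + 1 + m)`. -/
def sphereFrom (d : ℕ) (B : ℕ → Finset (Finset ℤ)) : ℕ → Finset (Finset ℤ)
  | 0 => crossPolytope (d + 1)
  | m + 1 => exchange (sphereFrom d B m) (B (d + 1 + m)) (d + 1 + m + 1)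

/-- `B^{d+1,i}_n = (B^{d,i}_{n-1} * n) ∪ ((-B^{d,i-1}_{n-1}) * (-n))`, where `B^{d,-1}` is empty;
the argument `P` is `(i, n) ↦ B^{d,i}_n`. -/
def ballStep (P : ℕ → ℕ → Finset (Finset ℤ)) : ℕ → ℕ → Finset (Finset ℤ)
  | 0, n => cone (P 0 (n - 1)) (n : ℤ)
  | i + 1, n => cone (P (i + 1) (n - 1)) (n : ℤ) ∪ cone (antipode (P i (n - 1))) (-(n : ℤ))

/-- The balls `B^{d,i}_n`, for `1 ≤ d`, `i ≤ ⌈d/2⌉` and `d + 1 ≤ n` (other values are irrelevant).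
See `ball_one_zero`, `ball_complement`, `ball_zero`, `ball_succ` for the defining equations. -/
def ball : ℕ → ℕ → ℕ → Finset (Finset ℤ)
  | 0 => fun _ _ => ∅
  | 1 => fun i n =>
      if i = 1 then sphereFrom 1 (fun m => {{-1, (m : ℤ)}}) (n - 2) \ {{-1, (n : ℤ)}}
      else {{-1, (n : ℤ)}}
  | d + 2 => fun i n =>
      if d + 3 = 2 * i then
        sphereFrom (d + 2) (ballStep (ball (d + 1)) (i - 1)) (n - (d + 3)) \
          ballStep (ball (d + 1)) (i - 1) n
      else ballStep (ball (d + 1)) i n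

/-- The set of facets of the sphere `Δ^d_n` of Novik and Zheng, for `1 ≤ d` and `d + 1 ≤ n`. It
arises from the boundary of the `(d + 1)`-dimensional cross-polytope by successively exchanging
the balls `±B^{d,⌈d/2⌉-1}_m` for `m = d + 1, …, n - 1`. -/
def sphereFacets (d n : ℕ) : Finset (Finset ℤ) :=
  sphereFrom d (ball d ((d + 1) / 2 - 1)) (n - (d + 1))

theorem sphereFacets_base (d : ℕ) : sphereFacets d (d + 1) = crossPolytope (d + 1) := by
  simp [sphereFacets, sphereFrom]

theorem sphereFacets_succ (d n : ℕ) (h : d + 1 ≤ n) :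
    sphereFacets d (n + 1) =
      exchange (sphereFacets d n) (ball d ((d + 1) / 2 - 1) n) (n + 1) := by
  obtain ⟨m, rfl⟩ := Nat.exists_eq_add_of_le h
  have h1 : d + 1 + m + 1 - (d + 1) = m + 1 := by omega
  have h2 : d + 1 + m - (d + 1) = m := by omega
  simp only [sphereFacets, h1, h2, sphereFrom]

theorem ball_one_zero (n : ℕ) : ball 1 0 n = {{-1, (n : ℤ)}} := by
  simp [ball]

theorem ball_zero (d n : ℕ) (hd : 1 ≤ d) :
    ball (d + 1) 0 n = cone (ball d 0 (n - 1)) (n : ℤ) := by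
  obtain ⟨e, rfl⟩ := Nat.exists_eq_add_of_le' hd
  simp [ball, ballStep]

theorem ball_succ (d i n : ℕ) (hd : 1 ≤ d) (hi : d + 2 ≠ 2 * (i + 1)) :
    ball (d + 1) (i + 1) n =
      cone (ball d (i + 1) (n - 1)) (n : ℤ) ∪ cone (antipode (ball d i (n - 1))) (-(n : ℤ)) := by
  obtain ⟨e, rfl⟩ := Nat.exists_eq_add_of_le' hd
  have h : ¬ (e + 3 = 2 * (i + 1)) := by omega
  simp [ball, ballStep, h]

theorem ball_complement (k n : ℕ) :
    ball (2 * k + 1) (k + 1) n = sphereFacets (2 * k + 1) n \ ball (2 * k + 1) k n := by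
  have h1 : (2 * k + 1 + 1) / 2 - 1 = k := by omega
  rw [sphereFacets, h1]
  rcases k with _ | k
  · have h : ball 1 0 = fun m : ℕ => {{-1, (m : ℤ)}} := by
      funext m
      exact ball_one_zero m
    rw [Nat.mul_zero, Nat.zero_add, h]
    simp [ball]
  · have h : ball (2 * k + 3) (k + 1) = ballStep (ball (2 * k + 2)) (k + 1) := by
      have h2 : ¬ (2 * k + 1 + 3 = 2 * (k + 1)) := by omega
      funext m
      simp [ball, h2]
    have h3 : 2 * (k + 1) + 1 = 2 * k + 3 := by omega
    have h4 : 2 * k + 1 + 3 = 2 * (k + 2) := by omega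
    rw [h3, h]
    simp [ball, h4]

/-- The abstract simplicial complex whose faces are the nonempty subsets of the given sets. -/
def complexOf (F : Finset (Finset ℤ)) : PreAbstractSimplicialComplex ℤ where
  faces := {σ | σ.Nonempty ∧ ∃ τ ∈ F, σ ⊆ τ}
  isRelLowerSet_faces := by
    rintro σ ⟨hσ, τ, hτ, hστ⟩
    exact ⟨hσ, fun ρ hρ hne => ⟨hne, τ, hτ, hρ.trans hστ⟩⟩

/-- The sphere `Δ^d_n` as an abstract simplicial complex. -/
def sphere (d n : ℕ) : PreAbstractSimplicialComplex ℤ :=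
  complexOf (sphereFacets d n)

/-- A simplicial complex `K` is realizable in `ℝ^D` if its vertices can be mapped to points
`x v` of `ℝ^D` such that for every face `σ` of `K` there is a hyperplane `⟪a, y⟫ = b` that
contains the convex hull of the points of `σ`, while the convex hull of the points of the
remaining vertices of `K` lies strictly on one side. (Values of `x` at non-vertices are unused.) -/
def IsRealizable {V : Type*} (K : PreAbstractSimplicialComplex V) (D : ℕ) : Prop :=
  ∃ x : V → EuclideanSpace ℝ (Fin D), ∀ σ ∈ K.faces,
    ∃ (a : EuclideanSpace ℝ (Fin D)) (b : ℝ), a ≠ 0 ∧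
      (∀ y ∈ convexHull ℝ (x '' {v | v ∈ σ}), inner ℝ a y = b) ∧
      (∀ y ∈ convexHull ℝ (x '' {v | {v} ∈ K.faces ∧ v ∉ σ}), inner ℝ a y < b)

end NovikZheng

/-! Lifting each point `x v` to `(x v, 1)` turns a realization in ℝ^D into vectors of ℝ^(D+1) such
that every face lies in the kernel of a linear form that is negative on all other vertices. The
vectors of a face are then independent (`linearIndepOn_face`), so for a facet `f` the determinants
[f, v], with v running over the vertices outside `f`, are nonzero and share one sign
(`bracket_mul_bracket_pos`). Determinants also satisfy [A,p,q][A,s,t] = [A,p,s][A,q,t] -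
[A,p,t][A,q,s], which forces the sign of [A,p,q] once the two products on the right have opposite
signs and [A,s,t] is known. For certain facets of Δ^3_5, and of Δ^4_6, these deductions end in a
contradiction. The deductions are recorded as finite certificates; `refutes` checks them, and
`not_refutes` is its soundness.

Two facts spread this computation to all d and n. The facets used lie outside the pair of balls
exchanged next, and every facet of a ball exchanged later contains a newest vertex, so they remain
facets of all Δ^3_m with m ≥ 5, respectively Δ^4_n with n ≥ 6 (`mem_sphereFacets_of_survives`).
Moreover, fixing the first vectors `τ` in all determinants yields a chirotope of lower rank for the
link of `τ`, so it suffices to find a link containing Δ^3_m. Passing to the link of the two largest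
vertices lowers odd d ≥ 5 by two; the link of the three largest takes even d ≥ 6 to odd d - 3. Only
d = 4 needs its own certificate.

The links come from `sphere_subset_boundary`: Δ^{2k+1}_n lies in the boundary of B^{2k+2,k+1}_n.
This belongs to the induction on d in `dimensionProperties`, simultaneous for balls and spheres. No
topology enters: the complexes are controlled by how many facets contain a given ridge. -/

/-! ### Chirotopes and refutations by Grassmann–Plücker relations -/

namespace NovikZheng

/-- The brackets `χ [v₁, …, v_r]` of a vector configuration: alternating, and satisfying the
three-term Grassmann–Plücker relations. -/
structure IsChirotope (χ : List ℤ → ℝ) (r : ℕ) : Prop where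
  swap : ∀ (A B : List ℤ) (x y : ℤ), A.length + B.length + 2 = r →
    χ (A ++ y :: x :: B) = -χ (A ++ x :: y :: B)
  plucker : ∀ (A : List ℤ) (p q s t : ℤ), A.length + 2 = r →
    χ (A ++ [p, q]) * χ (A ++ [s, t]) - χ (A ++ [p, s]) * χ (A ++ [q, t])
      + χ (A ++ [p, t]) * χ (A ++ [q, s]) = 0

/-- All the vertices in `V` outside `f` lie strictly on one side of the hyperplane through `f`. -/
def IsSupporting (χ : List ℤ → ℝ) (V : List ℤ) (f : List ℤ) : Prop :=
  ∀ v ∈ V, ∀ w ∈ V, v ∉ f → w ∉ f → 0 < χ (f ++ [v]) * χ (f ++ [w])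

/-- The sign `±1` encoded by a Boolean. -/
def boolSign (b : Bool) : ℝ := if b then 1 else -1

theorem boolSign_mul_self (b : Bool) : boolSign b * boolSign b = 1 := by
  cases b <;> norm_num [boolSign]

theorem boolSign_not (b : Bool) : boolSign (!b) = -boolSign b := by
  cases b <;> norm_num [boolSign]

theorem boolSign_beq (a b : Bool) : boolSign (a == b) = boolSign a * boolSign b := by
  cases a <;> cases b <;> norm_num [boolSign]

/-- Insertion into a sorted list, with the sign of the permutation. -/
def insertSign (x : ℤ) : List ℤ → Bool × List ℤ
  | [] => (true, [x])
  | y :: l => if x ≤ y then (true, x :: y :: l)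
      else let q := insertSign x l; (!q.1, y :: q.2)

/-- Insertion sort, with the sign of the permutation. -/
def sortSign : List ℤ → Bool × List ℤ
  | [] => (true, [])
  | x :: l => let q := sortSign l; let q' := insertSign x q.2; (q.1 == q'.1, q'.2)

theorem length_insertSign (x : ℤ) (l : List ℤ) :
    (insertSign x l).2.length = l.length + 1 := by
  induction l with
  | nil => rfl
  | cons y l ih =>
    unfold insertSign
    split_ifs <;> simp [ih]

theorem length_sortSign (l : List ℤ) : (sortSign l).2.length = l.length := by
  induction l with
  | nil => rfl
  | cons x l ih => simp [sortSign, length_insertSign, ih]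

/-- The prefix `A` carries the induction: one adjacent swap moves `x` past the head `y`, which then
joins the prefix. -/
theorem IsChirotope.insertSign {χ : List ℤ → ℝ} {r : ℕ} (hχ : IsChirotope χ r) (x : ℤ)
    (l : List ℤ) : ∀ A : List ℤ, A.length + l.length + 1 = r →
      χ (A ++ x :: l) = boolSign (insertSign x l).1 * χ (A ++ (NovikZheng.insertSign x l).2) := by
  induction l with
  | nil => intro A _; simp [NovikZheng.insertSign, boolSign]
  | cons y l ih =>
    intro A hA
    unfold NovikZheng.insertSign
    split_ifs with h
    · simp [boolSign]
    · have h1 := ih (A ++ [y]) (by simp at hA ⊢; omega)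
      simp only [List.append_assoc, List.singleton_append] at h1
      rw [hχ.swap A l y x (by simp at hA ⊢; omega), h1, boolSign_not]
      ring

theorem IsChirotope.sortSign {χ : List ℤ → ℝ} {r : ℕ} (hχ : IsChirotope χ r)
    (l : List ℤ) : ∀ A : List ℤ, A.length + l.length = r →
      χ (A ++ l) = boolSign (sortSign l).1 * χ (A ++ (NovikZheng.sortSign l).2) := by
  induction l with
  | nil => intro A _; simp [NovikZheng.sortSign, boolSign]
  | cons x l ih =>
    intro A hA
    have h1 := ih (A ++ [x]) (by simp at hA ⊢; omega)
    simp only [List.append_assoc, List.singleton_append] at h1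
    simp only [NovikZheng.sortSign]
    rw [h1, hχ.insertSign x _ A (by simp [length_sortSign] at hA ⊢; omega), boolSign_beq]
    ring

/-- Known signs of brackets, listed by their sorted entries. -/
abbrev SignTable := List (List ℤ × Bool)

/-- The brackets of `χ` have the signs listed in `T`. -/
def SignTable.Holds (T : SignTable) (χ : List ℤ → ℝ) (r : ℕ) : Prop :=
  ∀ e ∈ T, e.1.length = r ∧ 0 < boolSign e.2 * χ e.1

/-- The sign of a bracket, if it can be read off from the table. -/
def SignTable.sign? (T : SignTable) (l : List ℤ) : Option Bool :=
  (T.lookup (sortSign l).2).map fun b => b == (sortSign l).1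

/-- Record the sign of a bracket. -/
def SignTable.record (T : SignTable) (l : List ℤ) (b : Bool) : SignTable :=
  ((sortSign l).2, b == (sortSign l).1) :: T

theorem SignTable.Holds.of_lookup {T : SignTable} {χ : List ℤ → ℝ} {r : ℕ} (hT : T.Holds χ r)
    {l : List ℤ} {b : Bool} (h : T.lookup l = some b) : l.length = r ∧ 0 < boolSign b * χ l := by
  induction T with
  | nil => simp at h
  | cons e T ih =>
    obtain ⟨k, c⟩ := e
    rw [List.lookup_cons] at h
    by_cases hk : l == k
    · rw [hk] at h
      obtain rfl : l = k := by simpa using hk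
      obtain rfl : c = b := by simpa using h
      exact hT (l, c) (by simp)
    · simp only [hk] at h
      exact ih (fun e he => hT e (by simp [he])) h

theorem SignTable.Holds.sign {T : SignTable} {χ : List ℤ → ℝ} {r : ℕ} (hχ : IsChirotope χ r)
    (hT : T.Holds χ r) {l : List ℤ} {b : Bool} (h : T.sign? l = some b) :
    l.length = r ∧ 0 < boolSign b * χ l := by
  simp only [SignTable.sign?, Option.map_eq_some_iff] at h
  obtain ⟨c, hc, rfl⟩ := h
  obtain ⟨h1, h2⟩ := hT.of_lookup hc
  rw [length_sortSign] at h1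
  refine ⟨h1, ?_⟩
  have h3 := hχ.sortSign l [] (by simpa using h1)
  simp only [List.nil_append] at h3
  rw [h3, boolSign_beq]
  calc 0 < boolSign c * χ (sortSign l).2 := h2
    _ = boolSign c * (boolSign (sortSign l).1 * boolSign (sortSign l).1) * χ (sortSign l).2 := by
      rw [boolSign_mul_self]; ring
    _ = _ := by ring

theorem SignTable.Holds.record {T : SignTable} {χ : List ℤ → ℝ} {r : ℕ} (hχ : IsChirotope χ r)
    (hT : T.Holds χ r) {l : List ℤ} {b : Bool} (hl : l.length = r) (h : 0 < boolSign b * χ l) :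
    (T.record l b).Holds χ r := by
  intro e he
  rw [SignTable.record, List.mem_cons] at he
  obtain rfl | he := he
  · refine ⟨by rw [length_sortSign, hl], ?_⟩
    have h3 := hχ.sortSign l [] (by simpa using hl)
    simp only [List.nil_append] at h3
    rw [h3] at h
    rw [boolSign_beq]
    linarith
  · exact hT e he

/-- A step of a refutation: spread the sign of `χ (f ++ [v])` to all vertices outside the facet
`f`, or get the sign of `χ (A ++ [p, q])` from the three-term Grassmann–Plücker relation. -/
inductive RefutationStep
  | facet (f : List ℤ) (v : ℤ)
  | plucker (A : List ℤ) (p q s t : ℤ)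

/-- Whether a list of steps leads from the signs in the table to contradictory signs. -/
def refutes (V : List ℤ) : SignTable → List RefutationStep → Bool
  | _, [] => false
  | T, .facet f v :: S =>
    match T.sign? (f ++ [v]) with
    | some b => v ∈ V && v ∉ f &&
        refutes V ((V.filter (· ∉ f)).foldl (fun T w => T.record (f ++ [w]) b) T) S
    | none => false
  | T, .plucker A p q s t :: S =>
    match T.sign? (A ++ [s, t]), T.sign? (A ++ [p, s]), T.sign? (A ++ [q, t]),
      T.sign? (A ++ [p, t]), T.sign? (A ++ [q, s]) with
    | some b, some c₁, some c₂, some e₁, some e₂ =>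
      -- The products [A,p,s][A,q,t] and [A,p,t][A,q,s] must have opposite signs; their difference
      -- then has the sign `c₁ == c₂`, and dividing by [A,s,t] gives the sign of [A,p,q]. The
      -- refutation succeeds when the table already holds the opposite sign.
      (c₁ == c₂) != (e₁ == e₂) &&
        (T.sign? (A ++ [p, q]) == some !((c₁ == c₂) == b) ||
          refutes V (T.record (A ++ [p, q]) ((c₁ == c₂) == b)) S)
    | _, _, _, _, _ => false

/-- The facets that a refutation refers to. -/
def facetsUsed : List RefutationStep → List (List ℤ)
  | [] => []
  | .facet f _ :: S => f :: facetsUsed S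
  | .plucker _ _ _ _ _ :: S => facetsUsed S

theorem SignTable.Holds.foldl_record {χ : List ℤ → ℝ} {r : ℕ} (hχ : IsChirotope χ r)
    {f : List ℤ} {b : Bool} (hf : f.length + 1 = r) (U : List ℤ) :
    ∀ {T : SignTable}, T.Holds χ r → (∀ w ∈ U, 0 < boolSign b * χ (f ++ [w])) →
      SignTable.Holds (U.foldl (fun T w => T.record (f ++ [w]) b) T) χ r := by
  induction U with
  | nil => intro T hT _; exact hT
  | cons w U ih =>
    intro T hT h
    exact ih (hT.record hχ (by simpa using hf) (h w (by simp))) fun u hu => h u (by simp [hu])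

/-- Soundness of the checker: each step records only signs that `χ` really has, so success would
give one bracket two opposite strict signs. -/
theorem not_refutes {χ : List ℤ → ℝ} {r : ℕ} (hχ : IsChirotope χ r) {V : List ℤ}
    (S : List RefutationStep) : ∀ {T : SignTable}, T.Holds χ r →
      (∀ f ∈ facetsUsed S, IsSupporting χ V f) → refutes V T S = false := by
  induction S with
  | nil => intro T _ _; rfl
  | cons st S ih =>
    intro T hT hS
    by_contra hcon
    rw [Bool.not_eq_false] at hcon
    cases st with
    | facet f v =>
      simp only [refutes] at hcon
      split at hcon
      case h_2 => simp at hcon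
      case h_1 b hb =>
        simp only [Bool.and_eq_true, decide_eq_true_eq] at hcon
        obtain ⟨⟨hv, hvf⟩, hcon⟩ := hcon
        obtain ⟨hlen, hpos⟩ := hT.sign hχ hb
        have hT' : SignTable.Holds
            ((V.filter (· ∉ f)).foldl (fun T w => T.record (f ++ [w]) b) T) χ r := by
          refine SignTable.Holds.foldl_record hχ (by simpa using hlen) _ hT ?_
          intro w hw
          simp only [List.mem_filter, decide_eq_true_eq] at hw
          have h1 := hS f (by simp [facetsUsed]) v hv w hw.1 hvf hw.2
          by_contra hneg
          have h2 := mul_nonneg hpos.le (sub_nonneg.2 (not_lt.1 hneg))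
          have h3 := boolSign_mul_self b
          have h4 : boolSign b * χ (f ++ [v]) * (0 - boolSign b * χ (f ++ [w]))
            = -(boolSign b * boolSign b) * (χ (f ++ [v]) * χ (f ++ [w])) := by ring
          rw [h4, h3] at h2
          linarith
        rw [ih hT' fun g hg => hS g (by simp [facetsUsed, hg])] at hcon
        exact Bool.noConfusion hcon
    | plucker A p q s t =>
      simp only [refutes] at hcon
      split at hcon
      case h_2 => simp at hcon
      case h_1 b c₁ c₂ e₁ e₂ hb hc₁ hc₂ he₁ he₂ =>
        obtain ⟨hlen, hb⟩ := hT.sign hχ hb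
        obtain ⟨-, hc₁⟩ := hT.sign hχ hc₁
        obtain ⟨-, hc₂⟩ := hT.sign hχ hc₂
        obtain ⟨-, he₁⟩ := hT.sign hχ he₁
        obtain ⟨-, he₂⟩ := hT.sign hχ he₂
        simp only [Bool.and_eq_true, Bool.or_eq_true] at hcon
        obtain ⟨hne, hcon⟩ := hcon
        have hgp := hχ.plucker A p q s t (by simpa using hlen)
        have hc := mul_pos hc₁ hc₂
        have he := mul_pos he₁ he₂
        have hsgn : boolSign (e₁ == e₂) = -boolSign (c₁ == c₂) := by
          rw [← boolSign_not]
          congr 1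
          revert hne
          cases (c₁ == c₂) <;> cases (e₁ == e₂) <;> simp
        have hpq : 0 < boolSign ((c₁ == c₂) == b) * χ (A ++ [p, q]) := by
          rw [boolSign_beq, boolSign_beq] at hsgn
          rw [boolSign_beq, boolSign_beq]
          refine (mul_pos_iff_of_pos_right hb).1 ?_
          have h3 := boolSign_mul_self b
          -- Multiplied by the sign of the middle product, the relation becomes a sum of two
          -- positive products, because `hsgn` says that the third product has the opposite sign.
          have h4 : boolSign c₁ * boolSign c₂ * boolSign b * χ (A ++ [p, q]) *
              (boolSign b * χ (A ++ [s, t])) =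
              boolSign c₁ * χ (A ++ [p, s]) * (boolSign c₂ * χ (A ++ [q, t])) +
              boolSign e₁ * χ (A ++ [p, t]) * (boolSign e₂ * χ (A ++ [q, s])) := by
            linear_combination (boolSign c₁ * boolSign c₂) * hgp +
              (boolSign c₁ * boolSign c₂ * χ (A ++ [p, q]) * χ (A ++ [s, t])) * h3 -
              (χ (A ++ [p, t]) * χ (A ++ [q, s])) * hsgn
          rw [h4]
          exact add_pos hc he
        rcases hcon with hcon | hcon
        · have h5 := (hT.sign hχ (by simpa using hcon)).2
          rw [boolSign_not] at h5
          linarith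
        · rw [ih (hT.record hχ (by simpa using hlen) hpq)
            fun g hg => hS g (by simpa [facetsUsed] using hg)] at hcon
          exact Bool.noConfusion hcon

/-! ### The finite certificates in ranks 5 and 6 -/

theorem boolSign_decide_pos {x : ℝ} (hx : x ≠ 0) : 0 < boolSign (decide (0 < x)) * x := by
  rcases lt_or_gt_of_ne hx with h | h
  · simp [boolSign, h.not_gt, h]
  · simp [boolSign, h]

/-- The vertices `±1, …, ±m`. -/
def vertexList (m : ℕ) : List ℤ :=
  (List.range m).flatMap fun k => [(k + 1 : ℤ), -(k + 1 : ℤ)]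

/-- Refutation for `d = 3`, if `[1, 2, 3, 5]` and `[-3, 1, 2, 4]` have the same orientation. -/
def refutationSame : List RefutationStep :=
  [.facet [1, 2, 3, 5] (-5), .facet [-4, 1, 2, 3] 5, .facet [-3, 1, 2, 4] (-5),
   .facet [-3, -1, 2, 4] 1, .facet [-5, -1, 2, 4] (-3), .facet [-5, -3, 1, 2] 4,
   .plucker [1, 2, 5] (-5) 4 (-3) 3, .plucker [1, 2, 4] (-1) 5 (-5) (-3),
   .plucker [1, 2, 4] (-4) 5 (-3) 3, .plucker [1, 2, 5] (-4) (-1) 3 4, .facet [-4, -2, 1, 3] 2,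
   .facet [-4, -2, 1, 5] 3, .plucker [-4, 1, 2] (-2) (-1) 3 5, .facet [-4, -2, -1, 3] 1,
   .facet [-2, -1, 3, 5] (-4), .facet [-3, -2, -1, 4] 2, .facet [-5, -3, -2, -1] 4,
   .plucker [-2, -1, 5] (-5) 4 (-3) 3, .plucker [-2, -1, 4] 2 5 (-5) (-3),
   .facet [-4, -3, -2, 5] 1, .plucker [-4, -2, -1] 4 5 (-3) 3, .plucker [-2, -1, 5] (-4) 2 3 4,
   .plucker [-4, -2, -1] 1 2 3 5]

/-- Refutation for `d = 3`, if `[1, 2, 3, 5]` and `[-3, 1, 2, 4]` have opposite orientations. -/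
def refutationOpposite : List RefutationStep :=
  [.facet [1, 2, 3, 5] (-5), .facet [-2, 1, 3, 5] 2, .facet [-4, -2, 1, 5] 3,
   .facet [-5, -3, 1, 2] 4, .facet [-4, 1, 2, 3] 5, .plucker [-5, 1, 2] (-4) 5 (-3) 3,
   .facet [-3, 1, 2, 4] (-5), .plucker [1, 2, 5] (-5) 4 (-3) 3, .facet [-3, -1, 2, 4] 1,
   .facet [-5, -1, 2, 4] (-3), .plucker [-5, 1, 2] (-1) 5 (-3) 4,
   .plucker [1, 2, 5] (-4) (-1) (-5) 3, .facet [-5, -3, -1, 2] 1, .facet [-5, -3, -2, -1] 2,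
   .facet [-2, -1, 3, 5] 1, .facet [-4, -2, -1, 3] 5, .plucker [-5, -2, -1] (-4) 5 (-3) 3,
   .plucker [-2, -1, 5] (-5) 1 (-4) 3, .facet [-3, -2, -1, 4] 2,
   .plucker [-2, -1, 5] (-5) 4 (-3) 3, .plucker [-5, -2, -1] 2 5 (-3) 4,
   .plucker [-2, -1, 5] 1 2 (-5) 3, .plucker [1, 2, 5] (-4) (-2) (-1) 3]

/-- Refutation for `d = 4`. -/
def refutationFour : List RefutationStep :=
  [.facet [1, 2, 3, 4, 6] (-6), .facet [-2, 1, 3, 4, 6] 2, .facet [-2, -1, 3, 4, 6] 1,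
   .facet [-2, -1, 3, 5, 6] 4, .facet [-4, -2, -1, 3, 5] 6, .facet [-5, -4, -2, -1, 3] 5,
   .facet [-4, -3, -2, -1, 5] 3, .facet [-5, 1, 2, 3, 4] 6, .facet [-5, -3, 1, 2, 4] 3,
   .facet [-5, -3, -1, 2, 4] 1, .facet [-3, -1, 2, 4, 5] (-5), .facet [-3, -2, -1, 4, 5] 2,
   .plucker [-2, -1, 5, 6] (-4) 4 (-3) 3, .facet [-5, -3, -2, -1, 4] 2,
   .facet [-5, -2, -1, 3, 4] (-3), .plucker [-2, -1, 4, 5] (-5) 6 (-3) 3,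
   .facet [-6, -5, -3, -2, -1] 4, .facet [-6, -5, 2, 3, 4] 1, .facet [-6, -5, -1, 2, 4] 3,
   .plucker [-6, -5, -2, -1] (-4) 4 (-3) 3, .facet [-6, -5, -3, -1, 2] 4,
   .plucker [-6, -5, -2, -1] (-4) 2 (-3) 4, .facet [-6, -4, -3, -2, -1] (-5),
   .plucker [-6, -4, -2, -1] (-5) 5 (-3) 3, .facet [-5, -3, -2, 1, 4] 2,
   .facet [-5, -3, -2, 1, 6] 4, .facet [-5, -4, -3, -2, 6] 1,
   .plucker [-5, -4, -3, -2] (-1) 1 4 6, .plucker [-5, -4, -2, -1] (-6) 1 (-3) 3,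
   .facet [-5, -2, 1, 3, 4] 6, .facet [-5, -4, -2, 1, 3] 4, .facet [-5, -4, -2, 1, 6] 3,
   .plucker [-5, -4, -2, -1] (-6) 6 (-3) 1, .facet [-5, -4, 1, 2, 3] 4,
   .facet [-6, -5, -3, 1, 2] 4, .plucker [-6, -5, 2, 3] (-1) 1 (-3) 4,
   .plucker [-6, -5, 1, 2] (-4) (-1) (-3) 3, .facet [1, 2, 3, 5, 6] 4,
   .facet [-3, 1, 2, 4, 5] (-5), .facet [-6, -1, 2, 4, 5] (-3), .facet [-6, 2, 3, 4, 5] (-5),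
   .plucker [1, 2, 4, 5] (-1) 3 (-6) (-3), .facet [-4, -1, 2, 3, 5] (-2),
   .facet [-6, -4, -1, 2, 3] 5, .plucker [-6, -1, 2, 3] 1 4 (-5) (-4),
   .facet [-6, -1, 2, 3, 5] 4, .plucker [-1, 1, 2, 3] (-5) 5 (-6) 4,
   .plucker [-5, 1, 2, 3] (-1) 6 (-4) 5, .plucker [1, 2, 4, 5] (-6) 6 (-3) 3,
   .plucker [-6, 1, 2, 4] (-1) 6 3 5, .plucker [-6, 1, 2, 3] (-1) 6 4 5,
   .plucker [-6, -1, 1, 2] (-5) 6 3 4, .plucker [-5, -1, 1, 2] (-4) 6 (-6) 3,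
   .plucker [-5, -4, 1, 2] (-2) (-1) 3 6, .plucker [-5, -4, -2, -1] 2 6 (-6) 1,
   .facet [-4, -3, 1, 2, 5] 4, .facet [-4, -3, -1, 2, 5] 1,
   .plucker [-6, -1, 2, 5] (-5) (-4) (-3) 4, .plucker [-6, -4, -1, 3] (-5) 5 (-2) 2,
   .plucker [-5, -4, -1, 5] (-2) 2 (-6) 3, .plucker [-5, -4, -2, -1] 5 6 (-6) 2,
   .plucker [-5, -2, -1, 5] (-4) 4 3 6, .plucker [-5, -2, -1, 4] (-4) 2 (-6) (-3),
   .plucker [-5, -4, -2, -1] 4 6 2 3, .plucker [-4, -2, -1, 4] (-5) 3 5 6]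

-- Negating all brackets changes neither the Grassmann–Plücker relations nor the supporting
-- conditions. So of the four sign choices only equality or inequality of `b` and `c` matters, and
-- two certificates suffice.
set_option maxRecDepth 100000 in
theorem refutes_three (b c : Bool) :
    refutes (vertexList 5) [([-5, 1, 2, 3, 5], b), ([-5, -3, 1, 2, 4], c)]
      (if b = c then refutationSame else refutationOpposite) = true := by
  revert b c
  decide +kernel

set_option maxRecDepth 100000 in
theorem refutes_four (b : Bool) :
    refutes (vertexList 6) [([-6, 1, 2, 3, 4, 6], b)] refutationFour = true := by
  revert b
  decide +kernel

/-- In a chirotope of rank `5`, the listed facets are not all supporting. -/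
theorem exists_not_isSupporting_three {χ : List ℤ → ℝ} (hχ : IsChirotope χ 5) :
    ∃ f ∈ facetsUsed (refutationSame ++ refutationOpposite),
      ¬ IsSupporting χ (vertexList 5) f := by
  by_contra! h
  have happ : facetsUsed (refutationSame ++ refutationOpposite) =
      facetsUsed refutationSame ++ facetsUsed refutationOpposite := by decide +kernel
  rw [happ] at h
  have h1 : χ [-5, 1, 2, 3, 5] ≠ 0 := by
    intro h0
    -- Taking -5 for both outside vertices, the supporting condition says that a square is positive,
    -- so the bracket is nonzero and has a sign to start from.
    have h2 := h [1, 2, 3, 5] (by decide +kernel) (-5) (by decide) (-5) (by decide) (by decide)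
      (by decide)
    have h3 := hχ.sortSign [1, 2, 3, 5, -5] [] rfl
    have h4 : (sortSign [1, 2, 3, 5, -5]).2 = [-5, 1, 2, 3, 5] := by decide
    simp only [List.nil_append, h4, h0, mul_zero] at h3
    simp [h3] at h2
  have h2 : χ [-5, -3, 1, 2, 4] ≠ 0 := by
    intro h0
    have h2 := h [-3, 1, 2, 4] (by decide +kernel) (-5) (by decide) (-5) (by decide) (by decide)
      (by decide)
    have h3 := hχ.sortSign [-3, 1, 2, 4, -5] [] rfl
    have h4 : (sortSign [-3, 1, 2, 4, -5]).2 = [-5, -3, 1, 2, 4] := by decide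
    simp only [List.nil_append, h4, h0, mul_zero] at h3
    simp [h3] at h2
  have hT : SignTable.Holds [([-5, 1, 2, 3, 5], decide (0 < χ [-5, 1, 2, 3, 5])),
      ([-5, -3, 1, 2, 4], decide (0 < χ [-5, -3, 1, 2, 4]))] χ 5 := by
    intro e he
    simp only [List.mem_cons, List.not_mem_nil, or_false] at he
    rcases he with rfl | rfl
    · exact ⟨rfl, boolSign_decide_pos h1⟩
    · exact ⟨rfl, boolSign_decide_pos h2⟩
  have h3 := refutes_three (decide (0 < χ [-5, 1, 2, 3, 5])) (decide (0 < χ [-5, -3, 1, 2, 4]))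
  rw [not_refutes hχ _ hT] at h3
  · exact Bool.noConfusion h3
  · intro f hf
    split_ifs at hf
    · exact h f (List.mem_append_left _ hf)
    · exact h f (List.mem_append_right _ hf)

/-- In a chirotope of rank `6`, the listed facets are not all supporting. -/
theorem exists_not_isSupporting_four {χ : List ℤ → ℝ} (hχ : IsChirotope χ 6) :
    ∃ f ∈ facetsUsed refutationFour, ¬ IsSupporting χ (vertexList 6) f := by
  by_contra! h
  have h1 : χ [-6, 1, 2, 3, 4, 6] ≠ 0 := by
    intro h0
    have h2 := h [1, 2, 3, 4, 6] (by decide +kernel) (-6) (by decide) (-6) (by decide) (by decide)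
      (by decide)
    have h3 := hχ.sortSign [1, 2, 3, 4, 6, -6] [] rfl
    have h4 : (sortSign [1, 2, 3, 4, 6, -6]).2 = [-6, 1, 2, 3, 4, 6] := by decide
    simp only [List.nil_append, h4, h0, mul_zero] at h3
    simp [h3] at h2
  have hT : SignTable.Holds [([-6, 1, 2, 3, 4, 6], decide (0 < χ [-6, 1, 2, 3, 4, 6]))] χ 6 := by
    intro e he
    simp only [List.mem_cons, List.not_mem_nil, or_false] at he
    subst he
    exact ⟨rfl, boolSign_decide_pos h1⟩
  have h3 := refutes_four (decide (0 < χ [-6, 1, 2, 3, 4, 6]))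
  rw [not_refutes hχ _ hT h] at h3
  exact Bool.noConfusion h3

/-! ### Brackets of vector configurations -/

section Bracket

variable {W : Type*} [AddCommGroup W] [Module ℝ W]

/-- The three-term Grassmann–Plücker relation for a top-degree alternating form. -/
theorem plucker_update {ι : Type*} [Fintype ι] [DecidableEq ι] [FiniteDimensional ℝ W]
    (hι : Fintype.card ι = Module.finrank ℝ W) (ω : W [⋀^ι]→ₗ[ℝ] ℝ) (u : ι → W) {i j : ι}
    (hij : i ≠ j) (p q s t : W) :
    let B : W → W → ℝ := fun x y => ω (Function.update (Function.update u i x) j y)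
    B p q * B s t - B p s * B q t + B p t * B q s = 0 := by
  intro B
  have hcomm : ∀ x y, B x y = ω (Function.update (Function.update u j y) i x) := fun x y => by
    simp only [B]; rw [Function.update_comm hij]
  have hadd : ∀ x x' y, B (x + x') y = B x y + B x' y := fun x x' y => by
    rw [hcomm, hcomm, hcomm, ω.map_update_add]
  have hsmul : ∀ (c : ℝ) x y, B (c • x) y = c * B x y := fun c x y => by
    rw [hcomm, hcomm, ω.map_update_smul, smul_eq_mul]
  have hself : ∀ x, B x x = 0 := fun x =>
    ω.map_eq_zero_of_eq _ (i := i) (j := j) (by simp [hij]) hij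
  have hadd' : ∀ x y y', B x (y + y') = B x y + B x y' := fun x y y' => ω.map_update_add _ _ _ _
  have hanti : ∀ x y, B y x = -B x y := fun x y => by
    have h := hself (x + y)
    rw [hadd, hadd', hadd', hself, hself] at h
    linarith
  have hu : ∀ k y, k ≠ i → k ≠ j → B (u k) y = 0 := fun k y hki hkj =>
    ω.map_eq_zero_of_eq _ (i := i) (j := k) (by simp [hij, hki, hkj]) hki.symm
  -- If `B s t ≠ 0`, then `u` with `s`, `t` in places `i`, `j` is a basis. In the expansion of `p`
  -- the other basis vectors contribute nothing to `B p y`, as they would occur twice in the form.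
  have key : ∀ p q s t, B s t ≠ 0 → B p q * B s t - B p s * B q t + B p t * B q s = 0 := by
    intro p q s t hst
    set b := Function.update (Function.update u i s) j t with hb
    have hli : LinearIndependent ℝ b := by
      by_contra hcon
      exact hst (ω.map_linearDependent b hcon)
    let e := basisOfLinearIndependentOfCardEqFinrank' b hli hι
    have he : ⇑e = b := coe_basisOfLinearIndependentOfCardEqFinrank' b hli hι
    have hexp : ∀ y, B p y = e.repr p i * B s y + e.repr p j * B t y := by
      intro y
      let L : W →ₗ[ℝ] ℝ := ⟨⟨fun x => B x y, fun x x' => hadd x x' y⟩, fun c x => hsmul c x y⟩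
      have h1 : B p y = L (∑ k, e.repr p k • e k) := by rw [e.sum_repr]; rfl
      rw [h1, map_sum, ← Finset.sum_subset (Finset.subset_univ {i, j}), Finset.sum_pair hij]
      · simp [L, he, hb, hij]
      · intro k _ hk
        simp only [Finset.mem_insert, Finset.mem_singleton, not_or] at hk
        have h2 : L (e k) = 0 := by
          simp [L, he, hb, hk.1, hk.2, hu]
        rw [map_smul, h2, smul_zero]
    rw [hexp q, hexp s, hexp t, hself, hself, hanti s t, hanti s q, hanti t q]
    ring
  -- The relation is symmetric enough in `q`, `s`, `t` that any nonzero bracket among these three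
  -- can play the role of `B s t`; if all three vanish, it is trivial.
  by_cases h1 : B s t = 0
  · by_cases h2 : B q t = 0
    · by_cases h3 : B q s = 0
      · simp [h1, h2, h3]
      · have := key p t q s h3
        linear_combination this + B p q * hanti s t - B p s * hanti t q
    · have := key p s q t h2
      linear_combination -this + B p t * hanti s q
  · exact key p q s t h1

variable {r : ℕ}

/-- The value of a form of degree `r` at a list of `r` vectors. -/
def bracket (ω : W [⋀^Fin r]→ₗ[ℝ] ℝ) (L : List W) : ℝ :=
  ω fun i => L.getD i 0

/-- `bracket` reads a short list as padded with zeros, so appending a vector fills the first padded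
slot. -/
theorem getD_append_singleton {X : Type*} [Zero X] (L : List X) (w : X) (h : L.length < r) :
    (fun i : Fin r => (L ++ [w]).getD i 0) =
      Function.update (fun i : Fin r => L.getD i 0) ⟨L.length, h⟩ w := by
  funext i
  rcases lt_trichotomy (i : ℕ) L.length with hi | hi | hi
  · rw [Function.update_of_ne (fun hc => by rw [hc] at hi; simp at hi),
      List.getD_append _ _ _ _ hi]
  · obtain rfl : i = ⟨L.length, h⟩ := Fin.ext hi
    simp
  · rw [Function.update_of_ne (fun hc => by rw [hc] at hi; simp at hi),
      List.getD_eq_default _ _ hi.le, List.getD_eq_default _ _ (by simpa using hi)]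

theorem bracket_append_singleton (ω : W [⋀^Fin r]→ₗ[ℝ] ℝ) (L : List W) (w : W)
    (h : L.length < r) :
    bracket ω (L ++ [w]) = ω (Function.update (fun i : Fin r => L.getD i 0) ⟨L.length, h⟩ w) := by
  rw [bracket, getD_append_singleton L w h]

theorem bracket_swap (ω : W [⋀^Fin r]→ₗ[ℝ] ℝ) (A B : List W) (x y : W)
    (h : A.length + B.length + 2 = r) :
    bracket ω (A ++ y :: x :: B) = -bracket ω (A ++ x :: y :: B) := by
  have hne : (⟨A.length, by omega⟩ : Fin r) ≠ ⟨A.length + 1, by omega⟩ := by simp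
  rw [bracket, bracket, ← ω.map_swap _ hne]
  congr 1
  funext i
  simp only [Function.comp]
  rcases lt_or_ge (i : ℕ) A.length with hi | hi
  · rw [Equiv.swap_apply_of_ne_of_ne (fun hc => by rw [hc] at hi; simp at hi)
      (fun hc => by rw [hc] at hi; simp at hi), List.getD_append _ _ _ _ hi,
      List.getD_append _ _ _ _ hi]
  · obtain ⟨k, hk⟩ := Nat.exists_eq_add_of_le hi
    match k, hk with
    | 0, hk =>
      have hi' : i = ⟨A.length, by omega⟩ := Fin.ext hk
      simp [hi']
    | 1, hk =>
      have hi' : i = ⟨A.length + 1, by omega⟩ := Fin.ext hk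
      simp [hi']
    | k + 2, hk =>
      rw [Equiv.swap_apply_of_ne_of_ne (fun hc => by rw [hc] at hk; simp at hk)
        (fun hc => by rw [hc] at hk; simp at hk), List.getD_append_right _ _ _ _ hi,
        List.getD_append_right _ _ _ _ hi]
      have h3 : (i : ℕ) - A.length = k + 2 := by omega
      simp [h3]

theorem bracket_plucker [FiniteDimensional ℝ W] (hr : r = Module.finrank ℝ W)
    (ω : W [⋀^Fin r]→ₗ[ℝ] ℝ) (A : List W) (p q s t : W) (h : A.length + 2 = r) :
    bracket ω (A ++ [p, q]) * bracket ω (A ++ [s, t])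
      - bracket ω (A ++ [p, s]) * bracket ω (A ++ [q, t])
      + bracket ω (A ++ [p, t]) * bracket ω (A ++ [q, s]) = 0 := by
  have hB : ∀ x y, bracket ω (A ++ [x, y]) = ω (Function.update (Function.update
      (fun i : Fin r => A.getD i 0) ⟨A.length, by omega⟩ x) ⟨A.length + 1, by omega⟩ y) := by
    intro x y
    have h1 : A ++ [x, y] = (A ++ [x]) ++ [y] := by simp
    rw [h1, bracket_append_singleton _ _ _ (by simp; omega),
      getD_append_singleton A x (by omega)]
    simp
  simp only [hB]
  exact plucker_update (by simpa using hr) ω _ (by simp) p q s t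

/-- The chirotope of the contraction of a vector configuration by the vectors in `τ`. -/
theorem isChirotope_bracket [FiniteDimensional ℝ W] (hr : r = Module.finrank ℝ W)
    (ω : W [⋀^Fin r]→ₗ[ℝ] ℝ) (p : ℤ → W) (τ : List ℤ) {k : ℕ} (hk : τ.length + k = r) :
    IsChirotope (fun l => bracket ω ((τ ++ l).map p)) k where
  swap A B x y h := by
    have := bracket_swap ω ((τ ++ A).map p) (B.map p) (p x) (p y) (by simp; omega)
    simpa using this
  plucker A a b c d h := by
    have := bracket_plucker hr ω ((τ ++ A).map p) (p a) (p b) (p c) (p d) (by simp; omega)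
    simpa using this

/-- If a linear form vanishes on the `r - 1` independent vectors of `L` and is negative on `v` and
`w`, then `v` and `w` lie on the same side of the hyperplane spanned by `L`. -/
theorem bracket_mul_bracket_pos [FiniteDimensional ℝ W] (b : Module.Basis (Fin r) ℝ W)
    {L : List W} (hlen : L.length + 1 = r) (hL : LinearIndependent ℝ fun i : Fin L.length => L[i])
    (f : W →ₗ[ℝ] ℝ) (hf : ∀ x ∈ L, f x = 0) {v w : W} (hv : f v < 0) (hw : f w < 0) :
    0 < bracket b.det (L ++ [v]) * bracket b.det (L ++ [w]) := by
  have hr : Fintype.card (Fin r) = Module.finrank ℝ W := (Module.finrank_eq_card_basis b).symm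
  have hlt : L.length < r := by omega
  -- Otherwise `L` and `u` would span the space inside the kernel of `f`, against `f v < 0`.
  have hvanish : ∀ u, f u = 0 → bracket b.det (L ++ [u]) = 0 := by
    intro u hu
    by_contra hne
    have hli : LinearIndependent ℝ fun i : Fin r => (L ++ [u]).getD i 0 := by
      by_contra hcon
      exact hne (b.det.map_linearDependent _ hcon)
    have hspan := hli.span_eq_top_of_card_eq_finrank' hr
    have hf0 : f = 0 := by
      refine LinearMap.ext_on_range hspan fun i => ?_
      have hi : (i : ℕ) < (L ++ [u]).length := by simp; omega
      have hmem : (L ++ [u]).getD i 0 ∈ L ++ [u] := by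
        rw [List.getD_eq_getElem _ _ hi]; exact List.getElem_mem hi
      rw [List.mem_append, List.mem_singleton] at hmem
      rcases hmem with hmem | hmem
      · rw [hf _ hmem, LinearMap.zero_apply]
      · rw [hmem, hu, LinearMap.zero_apply]
    simp [hf0] at hv
  have hne : bracket b.det (L ++ [v]) ≠ 0 := by
    have hli : LinearIndependent ℝ fun i : Fin r => (L ++ [v]).getD i 0 := by
      subst hlen
      rw [linearIndependent_finSucc']
      have h1 : Fin.init (fun i : Fin (L.length + 1) => (L ++ [v]).getD i 0) =
          fun i : Fin L.length => L[i] := by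
        funext i
        simp only [Fin.init, Fin.val_castSucc]
        rw [List.getD_append _ _ _ _ i.2, List.getD_eq_getElem _ _ i.2]
        rfl
      rw [h1]
      refine ⟨hL, fun hmem => ?_⟩
      have h2 : Submodule.span ℝ (Set.range fun i : Fin L.length => L[i]) ≤ LinearMap.ker f := by
        rw [Submodule.span_le]
        rintro _ ⟨i, rfl⟩
        exact hf _ (List.getElem_mem i.2)
      have h3 := h2 hmem
      simp only [Fin.val_last] at h3
      rw [List.getD_append_right _ _ _ _ le_rfl] at h3
      simp at h3
      exact hv.ne h3
    exact ((b.is_basis_iff_det).1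
      ⟨hli, hli.span_eq_top_of_card_eq_finrank' hr⟩).ne_zero
  -- This combination lies in the kernel of `f`, so by linearity the brackets of `v` and `w` are in
  -- the same ratio as `f v` and `f w`, which is positive.
  have h := hvanish (f v • w - f w • v) (by simp [mul_comm])
  rw [bracket_append_singleton _ _ _ hlt, b.det.map_update_sub, b.det.map_update_smul,
    b.det.map_update_smul, ← bracket_append_singleton, ← bracket_append_singleton] at h
  simp only [smul_eq_mul] at h
  have h1 : bracket b.det (L ++ [v]) * bracket b.det (L ++ [w]) * f v =
      f w * (bracket b.det (L ++ [v]) * bracket b.det (L ++ [v])) := by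
    linear_combination bracket b.det (L ++ [v]) * h
  have h2 : bracket b.det (L ++ [v]) * bracket b.det (L ++ [w]) * f v < 0 := by
    rw [h1]; exact mul_neg_of_neg_of_pos hw (mul_self_pos.2 hne)
  exact pos_of_mul_neg_left h2 hv.le

end Bracket

/-! ### Realizations -/

section Realization

variable {K : PreAbstractSimplicialComplex ℤ} {D : ℕ}

/-- A realization yields a configuration of vectors in a `(D + 1)`-dimensional space in which every
face is supported by a linear form. -/
theorem IsRealizable.exists_vectors (h : IsRealizable K D) :
    ∃ p : ℤ → EuclideanSpace ℝ (Fin D) × ℝ, (∀ v, (p v).2 = 1) ∧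
      ∀ σ ∈ K.faces, ∃ f : (EuclideanSpace ℝ (Fin D) × ℝ) →ₗ[ℝ] ℝ,
        (∀ v ∈ σ, f (p v) = 0) ∧ ∀ v, {v} ∈ K.faces → v ∉ σ → f (p v) < 0 := by
  obtain ⟨x, hx⟩ := h
  refine ⟨fun v => (x v, 1), fun _ => rfl, fun σ hσ => ?_⟩
  obtain ⟨a, b, -, h0, h1⟩ := hx σ hσ
  -- The homogenized hyperplane: (y, t) ↦ ⟪a, y⟫ - b t.
  refine ⟨(innerₛₗ ℝ a).comp (LinearMap.fst ℝ _ _) - b • LinearMap.snd ℝ _ _, ?_, ?_⟩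
  · intro v hv
    have := h0 (x v) (subset_convexHull ℝ _ ⟨v, hv, rfl⟩)
    simp [this]
  · intro v hv hvσ
    have := h1 (x v) (subset_convexHull ℝ _ ⟨v, ⟨hv, hvσ⟩, rfl⟩)
    simpa using this

/-- Since the last coordinates are 1, the coefficients of a dependence sum to zero, so both signs
occur. The vertices with positive coefficient form a face. Its form vanishes there and is negative
on the rest of `σ`, so it takes a positive value on the dependence, which is absurd. -/
theorem linearIndepOn_face {W : Type*} [AddCommGroup W] [Module ℝ W] {p : ℤ → W × ℝ}
    (hp : ∀ v, (p v).2 = 1)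
    (hK : ∀ σ ∈ K.faces, ∃ f : (W × ℝ) →ₗ[ℝ] ℝ,
      (∀ v ∈ σ, f (p v) = 0) ∧ ∀ v, {v} ∈ K.faces → v ∉ σ → f (p v) < 0)
    {σ : Finset ℤ} (hσ : σ ∈ K.faces) : LinearIndepOn ℝ p (σ : Set ℤ) := by
  have hsub : ∀ τ ⊆ σ, τ.Nonempty → τ ∈ K.faces := fun τ h1 h2 =>
    (K.isRelLowerSet_faces hσ).2 h1 h2
  rw [linearIndepOn_finset_iff]
  intro c hc
  by_contra! hne
  have hsum : ∑ v ∈ σ, c v = 0 := by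
    have := congrArg Prod.snd hc
    simpa [Prod.snd_sum, hp] using this
  obtain ⟨u, huσ, hu⟩ := Finset.exists_pos_of_sum_zero_of_exists_nonzero c hsum hne
  have hneg : ∃ w ∈ σ, c w < 0 := by
    by_contra! hnn
    have := Finset.sum_pos' hnn ⟨u, huσ, hu⟩
    linarith
  obtain ⟨w, hwσ, hw⟩ := hneg
  obtain ⟨f, hf0, hf1⟩ := hK (σ.filter fun v => 0 < c v)
    (hsub _ (Finset.filter_subset _ _) ⟨u, by simp [huσ, hu]⟩)
  have hfneg : ∀ v ∈ σ, c v ≤ 0 → f (p v) < 0 := fun v hv hcv =>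
    hf1 v (hsub {v} (by simpa using hv) (by simp)) (by simp [hcv.not_gt])
  have hpos : 0 < ∑ v ∈ σ, c v * f (p v) := by
    refine Finset.sum_pos' (fun v hv => ?_) ⟨w, hwσ, mul_pos_of_neg_of_neg hw (hfneg w hwσ hw.le)⟩
    rcases le_or_gt (c v) 0 with h | h
    · exact mul_nonneg_of_nonpos_of_nonpos h (hfneg v hv h).le
    · rw [hf0 v (by simp [hv, h]), mul_zero]
  have h0 := congrArg f hc
  simp only [map_sum, map_smul, smul_eq_mul, map_zero] at h0
  linarith

/-- In a realizable complex the link of a face `τ` gives a chirotope all of whose facets are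
supporting. -/
theorem IsRealizable.exists_isChirotope (h : IsRealizable K D) (τ : List ℤ) {k : ℕ}
    (hk : τ.length + k = D + 1) :
    ∃ χ : List ℤ → ℝ, IsChirotope χ k ∧
      ∀ (f V : List ℤ), f.length + 1 = k → (τ ++ f).Nodup → (τ ++ f).toFinset ∈ K.faces →
        (∀ v ∈ V, {v} ∈ K.faces ∧ v ∉ τ) → IsSupporting χ V f := by
  obtain ⟨p, hp, hK⟩ := h.exists_vectors
  have hr : Module.finrank ℝ (EuclideanSpace ℝ (Fin D) × ℝ) = D + 1 := by simp
  let b := Module.finBasisOfFinrankEq ℝ _ hr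
  refine ⟨_, isChirotope_bracket hr.symm b.det p τ hk, ?_⟩
  intro f V hf hnd hface hV v hv w hw hvf hwf
  obtain ⟨g, hg0, hg1⟩ := hK _ hface
  have hli := linearIndepOn_face hp hK hface
  have hneg : ∀ v ∈ V, v ∉ f → g (p v) < 0 := fun v hv hvf =>
    hg1 v (hV v hv).1 (by simp [(hV v hv).2, hvf])
  have key := bracket_mul_bracket_pos b (L := (τ ++ f).map p) (by simp; omega) ?_ g ?_
    (hneg v hv hvf) (hneg w hw hwf)
  · simpa using key
  · have h1 : Function.Injective fun i : Fin ((τ ++ f).map p).length =>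
        (⟨(τ ++ f)[(i : ℕ)]'(by simpa using i.2), by
          simp only [SetLike.mem_coe, List.mem_toFinset]; exact List.getElem_mem _⟩ :
          ((τ ++ f).toFinset : Set ℤ)) := by
      intro i j hij
      have h2 := congrArg Subtype.val hij
      exact Fin.ext ((hnd.getElem_inj_iff).1 h2)
    have h2 := LinearIndependent.comp hli _ h1
    have h3 : (fun i : Fin ((τ ++ f).map p).length => ((τ ++ f).map p)[i]) =
        fun i : Fin ((τ ++ f).map p).length => p ((τ ++ f)[(i : ℕ)]'(by simpa using i.2)) := by
      funext i
      exact List.getElem_map p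
    rw [h3]
    exact h2
  · intro y hy
    rw [List.mem_map] at hy
    obtain ⟨v, hv, rfl⟩ := hy
    exact hg0 v (by simpa using hv)

end Realization

/-! ### Counting facets through a given face -/

/-- The number of facets of `F` that contain `r`. -/
def facetCount (F : Finset (Finset ℤ)) (r : Finset ℤ) : ℕ := (F.filter (r ⊆ ·)).card

/-- All facets have `c` vertices, and all vertices lie in `{-N, …, N}`. -/
def IsPure (F : Finset (Finset ℤ)) (c N : ℕ) : Prop :=
  ∀ σ ∈ F, σ.card = c ∧ ∀ v ∈ σ, v.natAbs ≤ N

variable {F G X Y B : Finset (Finset ℤ)} {r σ : Finset ℤ} {v : ℤ} {c n N : ℕ}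

theorem IsPure.mono (hF : IsPure F c N) (h : G ⊆ F) : IsPure G c N := fun σ hσ => hF σ (h hσ)

theorem IsPure.weaken (hF : IsPure F c N) (h : N ≤ n) : IsPure F c n := fun σ hσ =>
  ⟨(hF σ hσ).1, fun v hv => ((hF σ hσ).2 v hv).trans h⟩

theorem IsPure.union (hF : IsPure F c N) (hG : IsPure G c N) : IsPure (F ∪ G) c N := fun σ hσ =>
  (Finset.mem_union.1 hσ).elim (hF σ) (hG σ)

theorem isPure_empty : IsPure ∅ c N := fun σ hσ => absurd hσ (Finset.notMem_empty σ)

theorem IsPure.notMem (hF : IsPure F c N) (hσ : σ ∈ F) (hv : N < v.natAbs) : v ∉ σ := fun h =>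
  absurd ((hF σ hσ).2 v h) (not_le.2 hv)

theorem IsPure.cone (hF : IsPure F c N) (hv : N < v.natAbs) :
    IsPure (cone F v) (c + 1) v.natAbs := by
  intro σ hσ
  obtain ⟨ρ, hρ, rfl⟩ := Finset.mem_image.1 hσ
  refine ⟨by rw [Finset.card_insert_of_notMem (hF.notMem hρ hv), (hF ρ hρ).1], fun w hw => ?_⟩
  rcases Finset.mem_insert.1 hw with rfl | hw
  · exact le_rfl
  · exact ((hF ρ hρ).2 w hw).trans hv.le

theorem facetCount_mono (h : F ⊆ G) (r : Finset ℤ) : facetCount F r ≤ facetCount G r :=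
  Finset.card_le_card (Finset.filter_subset_filter _ h)

theorem facetCount_empty (r : Finset ℤ) : facetCount ∅ r = 0 := rfl

theorem facetCount_union (h : Disjoint F G) (r : Finset ℤ) :
    facetCount (F ∪ G) r = facetCount F r + facetCount G r := by
  rw [facetCount, Finset.filter_union, Finset.card_union_of_disjoint
    (Finset.disjoint_filter_filter h)]
  rfl

theorem facetCount_sdiff_add (h : G ⊆ F) (r : Finset ℤ) :
    facetCount (F \ G) r + facetCount G r = facetCount F r := by
  rw [← facetCount_union Finset.sdiff_disjoint, Finset.sdiff_union_of_subset h]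

theorem IsPure.facetCount_eq_zero (hF : IsPure F c N) (hv : v ∈ r) (hN : N < v.natAbs) :
    facetCount F r = 0 := by
  rw [facetCount, Finset.card_eq_zero, Finset.filter_eq_empty_iff]
  exact fun σ hσ hr => hF.notMem hσ hN (hr hv)

theorem IsPure.facetCount_eq_ite (hF : IsPure F c N) (hr : r.card = c) :
    facetCount F r = if r ∈ F then 1 else 0 := by
  have h : F.filter (r ⊆ ·) = F.filter (r = ·) := Finset.filter_congr fun σ hσ =>
    ⟨fun h => Finset.eq_of_subset_of_card_le h (by rw [hr, (hF σ hσ).1]), fun h => h.subset⟩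
  rw [facetCount, h, Finset.filter_eq]
  split_ifs <;> simp

theorem IsPure.mem_boundary (hF : IsPure F c N) :
    r ∈ boundary F ↔ r.card + 1 = c ∧ facetCount F r = 1 := by
  simp only [boundary, Finset.mem_filter, Finset.mem_biUnion, Finset.mem_image]
  constructor
  · rintro ⟨⟨σ, hσ, v, hv, rfl⟩, h⟩
    exact ⟨by rw [Finset.card_erase_add_one hv, (hF σ hσ).1], h⟩
  · rintro ⟨hr, h⟩
    refine ⟨?_, h⟩
    have hpos : 0 < (F.filter (r ⊆ ·)).card := by
      rw [facetCount] at h; omega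
    obtain ⟨σ, hσ⟩ := Finset.card_pos.1 hpos
    rw [Finset.mem_filter] at hσ
    have h1 : (σ \ r).card = 1 := by
      rw [Finset.card_sdiff_of_subset hσ.2, (hF σ hσ.1).1]; omega
    obtain ⟨v, hv⟩ := Finset.card_eq_one.1 h1
    have hvm : v ∈ σ \ r := by rw [hv]; simp
    refine ⟨σ, hσ.1, v, (Finset.mem_sdiff.1 hvm).1, ?_⟩
    rw [Finset.erase_eq, ← hv, Finset.sdiff_sdiff_eq_self hσ.2]

theorem IsPure.boundary (hF : IsPure F (c + 1) N) : IsPure (boundary F) c N := by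
  intro r hr
  obtain ⟨h1, h2⟩ := hF.mem_boundary.1 hr
  refine ⟨by omega, fun v hv => ?_⟩
  by_contra hN
  rw [hF.facetCount_eq_zero hv (not_le.1 hN)] at h2
  omega

theorem IsPure.facetCount_boundary (hF : IsPure F (c + 1) N) (hr : r.card = c) :
    facetCount (NovikZheng.boundary F) r = if facetCount F r = 1 then 1 else 0 := by
  rw [hF.boundary.facetCount_eq_ite hr]
  simp [hF.mem_boundary, hr]

theorem insert_injOn {σ τ : Finset ℤ} (hσ : v ∉ σ) (hτ : v ∉ τ) (h : insert v σ = insert v τ) :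
    σ = τ := by
  rw [← Finset.erase_insert hσ, h, Finset.erase_insert hτ]

theorem IsPure.facetCount_cone (hF : IsPure F c N) (hv : N < v.natAbs) (r : Finset ℤ) :
    facetCount (NovikZheng.cone F v) r = facetCount F (r.erase v) := by
  have h : (NovikZheng.cone F v).filter (r ⊆ ·) =
      (F.filter (r.erase v ⊆ ·)).image (insert v ·) := by
    ext σ
    simp only [NovikZheng.cone, Finset.mem_filter, Finset.mem_image]
    constructor
    · rintro ⟨⟨ρ, hρ, rfl⟩, h⟩
      exact ⟨ρ, ⟨hρ, Finset.subset_insert_iff.1 h⟩, rfl⟩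
    · rintro ⟨ρ, ⟨hρ, h⟩, rfl⟩
      exact ⟨⟨ρ, hρ, rfl⟩, Finset.subset_insert_iff.2 h⟩
  rw [facetCount, h, Finset.card_image_of_injOn]
  · rfl
  · intro σ hσ τ hτ hστ
    simp only [Finset.coe_filter, Set.mem_ofPred_eq] at hσ hτ
    exact insert_injOn (hF.notMem hσ.1 hv) (hF.notMem hτ.1 hv) hστ

/-! ### The antipodal map -/

/-- The antipodal image of a face. -/
abbrev opposite (σ : Finset ℤ) : Finset ℤ := σ.image fun v => -v

theorem opposite_opposite (σ : Finset ℤ) : opposite (opposite σ) = σ := by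
  simp [opposite, Finset.image_image]

theorem opposite_injective : Function.Injective opposite :=
  Function.LeftInverse.injective opposite_opposite

theorem mem_opposite : v ∈ opposite σ ↔ -v ∈ σ := by
  simp [opposite, neg_eq_iff_eq_neg]

theorem card_opposite (σ : Finset ℤ) : (opposite σ).card = σ.card :=
  Finset.card_image_of_injective _ neg_injective

theorem mem_antipode : σ ∈ antipode F ↔ opposite σ ∈ F := by
  simp only [antipode, Finset.mem_image]
  constructor
  · rintro ⟨τ, hτ, rfl⟩
    rwa [opposite_opposite]
  · exact fun h => ⟨_, h, opposite_opposite σ⟩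

theorem antipode_antipode (F : Finset (Finset ℤ)) : antipode (antipode F) = F := by
  ext σ
  rw [mem_antipode, mem_antipode, opposite_opposite]

theorem antipode_mono (h : F ⊆ G) : antipode F ⊆ antipode G := Finset.image_subset_image h

theorem antipode_union (F G : Finset (Finset ℤ)) :
    antipode (F ∪ G) = antipode F ∪ antipode G := Finset.image_union _ _

theorem antipode_sdiff (F G : Finset (Finset ℤ)) :
    antipode (F \ G) = antipode F \ antipode G := by
  ext σ
  simp only [mem_antipode, Finset.mem_sdiff]

theorem antipode_cone (F : Finset (Finset ℤ)) (v : ℤ) :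
    antipode (cone F v) = cone (antipode F) (-v) := by
  simp [antipode, cone, Finset.image_image, Function.comp_def, Finset.image_insert]

theorem disjoint_antipode (h : Disjoint F G) : Disjoint (antipode F) (antipode G) :=
  Finset.disjoint_left.2 fun _ h1 h2 =>
    Finset.disjoint_left.1 h (mem_antipode.1 h1) (mem_antipode.1 h2)

theorem IsPure.antipode (hF : IsPure F c N) : IsPure (antipode F) c N := by
  intro σ hσ
  obtain ⟨h1, h2⟩ := hF _ (mem_antipode.1 hσ)
  refine ⟨by rw [← h1, card_opposite], fun v hv => ?_⟩
  simpa using h2 (-v) (by rw [mem_opposite]; simpa using hv)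

theorem facetCount_antipode (F : Finset (Finset ℤ)) (r : Finset ℤ) :
    facetCount (antipode F) r = facetCount F (opposite r) := by
  have h : (antipode F).filter (r ⊆ ·) = (F.filter (opposite r ⊆ ·)).image opposite := by
    ext σ
    simp only [Finset.mem_filter, Finset.mem_image, mem_antipode]
    constructor
    · rintro ⟨h1, h2⟩
      exact ⟨_, ⟨h1, Finset.image_subset_image h2⟩, opposite_opposite σ⟩
    · rintro ⟨τ, ⟨h1, h2⟩, rfl⟩
      rw [opposite_opposite]
      refine ⟨h1, ?_⟩
      have := Finset.image_subset_image (f := fun v : ℤ => -v) h2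
      rwa [show (opposite r).image (fun v => -v) = r from opposite_opposite r] at this
  rw [facetCount, h, Finset.card_image_of_injective _ opposite_injective]
  rfl

theorem IsPure.boundary_antipode (hF : IsPure F c N) :
    NovikZheng.boundary (NovikZheng.antipode F) =
      NovikZheng.antipode (NovikZheng.boundary F) := by
  ext r
  rw [hF.antipode.mem_boundary, mem_antipode, hF.mem_boundary, facetCount_antipode, card_opposite]

/-! ### Two opposite cones -/

/-- The union of the cone over `X` with apex `n` and the cone over `Y` with apex `-n`. -/
def twoCones (X Y : Finset (Finset ℤ)) (n : ℕ) : Finset (Finset ℤ) :=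
  cone X (n : ℤ) ∪ cone Y (-(n : ℤ))

theorem twoCones_mono {X' Y' : Finset (Finset ℤ)} (hX : X ⊆ X') (hY : Y ⊆ Y') (n : ℕ) :
    twoCones X Y n ⊆ twoCones X' Y' n :=
  Finset.union_subset_union (Finset.image_subset_image hX) (Finset.image_subset_image hY)

theorem antipode_twoCones (X Y : Finset (Finset ℤ)) (n : ℕ) :
    antipode (twoCones X Y n) = twoCones (antipode Y) (antipode X) n := by
  rw [twoCones, antipode_union, antipode_cone, antipode_cone, neg_neg, Finset.union_comm, twoCones]

theorem mem_cone_of_mem (h : σ ∈ F) : insert v σ ∈ cone F v := Finset.mem_image_of_mem _ h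

theorem disjoint_cone {v : ℤ} (hX : IsPure X c N) (hY : IsPure Y c N) (hv : N < v.natAbs)
    (h : Disjoint X Y) : Disjoint (cone X v) (cone Y v) := by
  rw [Finset.disjoint_left]
  intro σ h1 h2
  obtain ⟨x, hx, rfl⟩ := Finset.mem_image.1 h1
  obtain ⟨y, hy, hxy⟩ := Finset.mem_image.1 h2
  obtain rfl := insert_injOn (hY.notMem hy hv) (hX.notMem hx hv) hxy
  exact Finset.disjoint_left.1 h hx hy

theorem disjoint_cone_cone_neg (hY : IsPure Y c N) (hn : N < n) :
    Disjoint (cone X (n : ℤ)) (cone Y (-(n : ℤ))) := by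
  rw [Finset.disjoint_left]
  intro σ h1 h2
  obtain ⟨x, -, rfl⟩ := Finset.mem_image.1 h1
  obtain ⟨y, hy, hxy⟩ := Finset.mem_image.1 h2
  have h3 : (n : ℤ) ∈ insert (-(n : ℤ)) y := by rw [hxy]; simp
  rcases Finset.mem_insert.1 h3 with h3 | h3
  · omega
  · exact hY.notMem hy (by simpa using hn) h3

theorem disjoint_twoCones {X' Y' : Finset (Finset ℤ)} (hX : IsPure X c N) (hY : IsPure Y c N)
    (hX' : IsPure X' c N) (hY' : IsPure Y' c N) (hn : N < n) (h : Disjoint X X')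
    (h' : Disjoint Y Y') : Disjoint (twoCones X Y n) (twoCones X' Y' n) := by
  rw [twoCones, twoCones, Finset.disjoint_union_left, Finset.disjoint_union_right,
    Finset.disjoint_union_right]
  exact ⟨⟨disjoint_cone hX hX' (by simpa using hn) h, disjoint_cone_cone_neg hY' hn⟩,
    (disjoint_cone_cone_neg hY hn).symm, disjoint_cone hY hY' (by simpa using hn) h'⟩

theorem isPure_twoCones (hX : IsPure X c N) (hY : IsPure Y c N) (hn : N < n) :
    IsPure (twoCones X Y n) (c + 1) n :=
  (by simpa using hX.cone (v := (n : ℤ)) (by simpa using hn) : IsPure _ (c + 1) n).union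
    (by simpa using hY.cone (v := -(n : ℤ)) (by simpa using hn))

theorem facetCount_twoCones (hX : IsPure X c N) (hY : IsPure Y c N) (hn : N < n) (r : Finset ℤ) :
    facetCount (twoCones X Y n) r =
      facetCount X (r.erase (n : ℤ)) + facetCount Y (r.erase (-(n : ℤ))) := by
  rw [twoCones, facetCount_union (disjoint_cone_cone_neg hY hn),
    hX.facetCount_cone (by simpa using hn), hY.facetCount_cone (by simpa using hn)]

theorem facetCount_twoCones_of_mem (hX : IsPure X c N) (hY : IsPure Y c N) (hn : N < n)
    (h : (n : ℤ) ∈ r) : facetCount (twoCones X Y n) r = facetCount X (r.erase (n : ℤ)) := by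
  rw [facetCount_twoCones hX hY hn, hY.facetCount_eq_zero (v := n) _ (by simpa using hn), add_zero]
  exact Finset.mem_erase.2 ⟨by omega, h⟩

theorem facetCount_twoCones_of_neg_mem (hX : IsPure X c N) (hY : IsPure Y c N) (hn : N < n)
    (h : -(n : ℤ) ∈ r) :
    facetCount (twoCones X Y n) r = facetCount Y (r.erase (-(n : ℤ))) := by
  rw [facetCount_twoCones hX hY hn, hX.facetCount_eq_zero (v := -n) _ (by simpa using hn), zero_add]
  exact Finset.mem_erase.2 ⟨by omega, h⟩

theorem facetCount_twoCones_of_notMem (hX : IsPure X c N) (hY : IsPure Y c N) (hn : N < n)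
    (h : (n : ℤ) ∉ r) (h' : -(n : ℤ) ∉ r) :
    facetCount (twoCones X Y n) r = facetCount X r + facetCount Y r := by
  rw [facetCount_twoCones hX hY hn, Finset.erase_eq_of_notMem h, Finset.erase_eq_of_notMem h']

theorem card_erase_of_mem {v : ℤ} (hr : r.card = c + 1) (hv : v ∈ r) : (r.erase v).card = c := by
  rw [Finset.card_erase_of_mem hv, hr, Nat.add_sub_cancel]

theorem facetCount_twoCones_le (hX : IsPure X (c + 1) N) (hY : IsPure Y (c + 1) N) (hn : N < n)
    (hX2 : ∀ r : Finset ℤ, r.card = c → facetCount X r ≤ 2)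
    (hY2 : ∀ r : Finset ℤ, r.card = c → facetCount Y r ≤ 2) (hr : r.card = c + 1) :
    facetCount (twoCones X Y n) r ≤ 2 := by
  by_cases h : (n : ℤ) ∈ r
  · rw [facetCount_twoCones_of_mem hX hY hn h]
    exact hX2 _ (card_erase_of_mem hr h)
  by_cases h' : -(n : ℤ) ∈ r
  · rw [facetCount_twoCones_of_neg_mem hX hY hn h']
    exact hY2 _ (card_erase_of_mem hr h')
  rw [facetCount_twoCones_of_notMem hX hY hn h h', hX.facetCount_eq_ite hr,
    hY.facetCount_eq_ite hr]
  split_ifs <;> omega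

theorem mem_boundary_twoCones_of_mem (hX : IsPure X c N) (hY : IsPure Y c N) (hn : N < n)
    (h : (n : ℤ) ∈ r) :
    r ∈ boundary (twoCones X Y n) ↔ r.erase (n : ℤ) ∈ boundary X := by
  rw [(isPure_twoCones hX hY hn).mem_boundary, hX.mem_boundary, Finset.card_erase_add_one h,
    facetCount_twoCones_of_mem hX hY hn h, Nat.add_right_cancel_iff]

theorem mem_boundary_twoCones_of_neg_mem (hX : IsPure X c N) (hY : IsPure Y c N) (hn : N < n)
    (h : -(n : ℤ) ∈ r) :
    r ∈ boundary (twoCones X Y n) ↔ r.erase (-(n : ℤ)) ∈ boundary Y := by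
  rw [(isPure_twoCones hX hY hn).mem_boundary, hY.mem_boundary, Finset.card_erase_add_one h,
    facetCount_twoCones_of_neg_mem hX hY hn h, Nat.add_right_cancel_iff]

/-- Such a ridge is counted once for `X` and once for `Y`; as `Y ⊆ X`, the total is one exactly on
the difference. -/
theorem mem_boundary_twoCones_of_notMem (hX : IsPure X c N) (hY : IsPure Y c N) (hn : N < n)
    (hYX : Y ⊆ X) (h : (n : ℤ) ∉ r) (h' : -(n : ℤ) ∉ r) :
    r ∈ boundary (twoCones X Y n) ↔ r ∈ X \ Y := by
  rw [(isPure_twoCones hX hY hn).mem_boundary, facetCount_twoCones_of_notMem hX hY hn h h',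
    Nat.add_right_cancel_iff, Finset.mem_sdiff]
  constructor
  · rintro ⟨hr, h1⟩
    rw [hX.facetCount_eq_ite hr, hY.facetCount_eq_ite hr] at h1
    have := @hYX r
    by_cases hx : r ∈ X <;> by_cases hy : r ∈ Y <;> simp_all
  · rintro ⟨hx, hy⟩
    have hr := (hX r hx).1
    rw [hX.facetCount_eq_ite hr, hY.facetCount_eq_ite hr]
    simp [hx, hy, hr]

theorem twoCones_boundary_subset (hX : IsPure X c N) (hY : IsPure Y c N) (hn : N < n) :
    twoCones (boundary X) (boundary Y) n ⊆ boundary (twoCones X Y n) := by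
  intro r hr
  rcases Finset.mem_union.1 hr with hr | hr
  · obtain ⟨x, hx, rfl⟩ := Finset.mem_image.1 hr
    rw [mem_boundary_twoCones_of_mem hX hY hn (Finset.mem_insert_self _ _), Finset.erase_insert]
    · exact hx
    · intro hmem
      have := (hX.mem_boundary.1 hx).2
      rw [hX.facetCount_eq_zero hmem (by simpa using hn)] at this
      omega
  · obtain ⟨y, hy, rfl⟩ := Finset.mem_image.1 hr
    rw [mem_boundary_twoCones_of_neg_mem hX hY hn (Finset.mem_insert_self _ _),
      Finset.erase_insert]
    · exact hy
    · intro hmem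
      have := (hY.mem_boundary.1 hy).2
      rw [hY.facetCount_eq_zero hmem (by simpa using hn)] at this
      omega

theorem sdiff_subset_boundary_twoCones (hX : IsPure X c N) (hY : IsPure Y c N) (hn : N < n)
    (hYX : Y ⊆ X) : X \ Y ⊆ boundary (twoCones X Y n) := by
  intro r hr
  have hrX := (Finset.mem_sdiff.1 hr).1
  exact (mem_boundary_twoCones_of_notMem hX hY hn hYX (hX.notMem hrX (by simpa using hn))
    (hX.notMem hrX (by simpa using hn))).2 hr

/-- Every ridge lies in no or in exactly two facets; `c` is the number of vertices of a ridge. -/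
def IsClosed (F : Finset (Finset ℤ)) (c : ℕ) : Prop :=
  ∀ r : Finset ℤ, r.card = c → facetCount F r = 0 ∨ facetCount F r = 2

theorem boundary_twoCones (hX : IsPure X (c + 1) N) (hY : IsPure Y (c + 1) N) (hn : N < n)
    (hYX : Y ⊆ X) :
    boundary (twoCones X Y n) = twoCones (boundary X) (boundary Y) n ∪ (X \ Y) := by
  refine Finset.Subset.antisymm (fun r hr => ?_) (Finset.union_subset
    (twoCones_boundary_subset hX hY hn) (sdiff_subset_boundary_twoCones hX hY hn hYX))
  by_cases h : (n : ℤ) ∈ r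
  · rw [mem_boundary_twoCones_of_mem hX hY hn h] at hr
    rw [← Finset.insert_erase h]
    exact Finset.mem_union_left _ (Finset.mem_union_left _ (mem_cone_of_mem hr))
  by_cases h' : -(n : ℤ) ∈ r
  · rw [mem_boundary_twoCones_of_neg_mem hX hY hn h'] at hr
    rw [← Finset.insert_erase h']
    exact Finset.mem_union_left _ (Finset.mem_union_right _ (mem_cone_of_mem hr))
  exact Finset.mem_union_right _ ((mem_boundary_twoCones_of_notMem hX hY hn hYX h h').1 hr)

/-- Ridges through `±n` reduce to the boundaries of `X` and `Y`. Any other set `r` lies in x facets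
of `X` and y of `Y`, with y ≤ x ≤ 2, and its count x - y + [x = 1] + [y = 1] is always 0 or 2. -/
theorem isClosed_boundary_twoCones (hX : IsPure X (c + 1) N) (hY : IsPure Y (c + 1) N)
    (hn : N < n) (hYX : Y ⊆ X) (hX2 : ∀ r : Finset ℤ, r.card = c → facetCount X r ≤ 2)
    (hXc : ∀ b, b + 1 = c → IsClosed (boundary X) b)
    (hYc : ∀ b, b + 1 = c → IsClosed (boundary Y) b) :
    IsClosed (boundary (twoCones X Y n)) c := by
  intro r hr
  have hbX := hX.boundary
  have hbY := hY.boundary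
  have hdisj : Disjoint (twoCones (boundary X) (boundary Y) n) (X \ Y) := by
    rw [Finset.disjoint_left]
    intro σ h1 h2
    have hσ := (Finset.mem_sdiff.1 h2).1
    rcases Finset.mem_union.1 h1 with h1 | h1
    · obtain ⟨x, -, rfl⟩ := Finset.mem_image.1 h1
      exact hX.notMem hσ (by simpa using hn) (Finset.mem_insert_self (n : ℤ) x)
    · obtain ⟨x, -, rfl⟩ := Finset.mem_image.1 h1
      exact hX.notMem hσ (by simpa using hn) (Finset.mem_insert_self (-(n : ℤ)) x)
  rw [boundary_twoCones hX hY hn hYX, facetCount_union hdisj]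
  by_cases h : (n : ℤ) ∈ r
  · rw [facetCount_twoCones_of_mem hbX hbY hn h,
      (hX.mono Finset.sdiff_subset).facetCount_eq_zero h (by simpa using hn), add_zero]
    have := Finset.card_erase_add_one h
    exact hXc _ (this.trans hr) _ rfl
  by_cases h' : -(n : ℤ) ∈ r
  · rw [facetCount_twoCones_of_neg_mem hbX hbY hn h',
      (hX.mono Finset.sdiff_subset).facetCount_eq_zero h' (by simpa using hn), add_zero]
    have := Finset.card_erase_add_one h'
    exact hYc _ (this.trans hr) _ rfl
  have h1 := facetCount_sdiff_add hYX r
  have h2 := facetCount_mono hYX r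
  have h3 := hX2 r hr
  rw [facetCount_twoCones_of_notMem hbX hbY hn h h', hX.facetCount_boundary hr,
    hY.facetCount_boundary hr]
  split_ifs <;> omega

/-- Complements in a closed complex have the same boundary. -/
theorem boundary_sdiff (hF : IsPure F (c + 1) N) (hcl : IsClosed F c) (hB : B ⊆ F) :
    boundary (F \ B) = boundary B := by
  ext r
  rw [(hF.mono Finset.sdiff_subset).mem_boundary, (hF.mono hB).mem_boundary]
  refine and_congr_right fun hr => ?_
  have h1 := facetCount_sdiff_add hB r
  have h2 := hcl r (by omega)
  omega

/-! ### The exchange -/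

theorem exchange_eq (hB : IsPure B c N) (n : ℕ) :
    exchange F B n = (F \ (B ∪ antipode B)) ∪
      twoCones (boundary B) (antipode (boundary B)) n := by
  rw [exchange, hB.boundary_antipode, twoCones]

theorem isPure_exchange (hF : IsPure F (c + 1) N) (hB : IsPure B (c + 1) N) (hn : N < n) :
    IsPure (exchange F B n) (c + 1) n := by
  rw [exchange_eq hB]
  exact ((hF.mono Finset.sdiff_subset).weaken hn.le).union
    (isPure_twoCones hB.boundary hB.boundary.antipode hn)

theorem antipode_exchange (hF : antipode F = F) (hB : IsPure B c N) (n : ℕ) :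
    antipode (exchange F B n) = exchange F B n := by
  rw [exchange_eq hB, antipode_union, antipode_sdiff, antipode_union, antipode_antipode, hF,
    antipode_twoCones, antipode_antipode, Finset.union_comm (antipode B)]

theorem isClosed_antipode (hF : IsClosed F c) : IsClosed (antipode F) c := fun r hr => by
  rw [facetCount_antipode]
  exact hF _ (by rw [card_opposite, hr])

/-- Away from `±n`, let x and y count the facets of `B` and `-B` through `r`. By disjointness x + y
is at most the old count, 0 or 2. Removing these and adding one for each of x, y equal to 1 leaves 0
or 2. -/
theorem isClosed_exchange (hF : IsPure F (c + 1) N) (hsymm : antipode F = F) (hcl : IsClosed F c)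
    (hBF : B ⊆ F) (hB : Disjoint B (antipode B)) (hBc : ∀ b, b + 1 = c → IsClosed (boundary B) b)
    (hn : N < n) : IsClosed (exchange F B n) c := by
  intro r hr
  have hpB := hF.mono hBF
  have hBF' : B ∪ antipode B ⊆ F :=
    Finset.union_subset hBF (by rw [← hsymm]; exact antipode_mono hBF)
  have hpS := hF.mono (Finset.sdiff_subset (s := F) (t := B ∪ antipode B))
  have hbB := hpB.boundary
  have hdisj : Disjoint (F \ (B ∪ antipode B))
      (twoCones (boundary B) (antipode (boundary B)) n) := by
    rw [Finset.disjoint_left]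
    intro σ hσ h1
    rcases Finset.mem_union.1 h1 with h1 | h1
    · obtain ⟨x, -, rfl⟩ := Finset.mem_image.1 h1
      exact hpS.notMem hσ (by simpa using hn) (Finset.mem_insert_self (n : ℤ) x)
    · obtain ⟨x, -, rfl⟩ := Finset.mem_image.1 h1
      exact hpS.notMem hσ (by simpa using hn) (Finset.mem_insert_self (-(n : ℤ)) x)
  rw [exchange_eq hpB, facetCount_union hdisj]
  by_cases h : (n : ℤ) ∈ r
  · rw [facetCount_twoCones_of_mem hbB hbB.antipode hn h,
      hpS.facetCount_eq_zero h (by simpa using hn), zero_add]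
    exact hBc _ ((Finset.card_erase_add_one h).trans hr) _ rfl
  by_cases h' : -(n : ℤ) ∈ r
  · rw [facetCount_twoCones_of_neg_mem hbB hbB.antipode hn h',
      hpS.facetCount_eq_zero h' (by simpa using hn), zero_add]
    exact isClosed_antipode (hBc _ ((Finset.card_erase_add_one h').trans hr)) _ rfl
  have h1 := facetCount_sdiff_add hBF' r
  have h2 := facetCount_union hB r
  have h3 := hcl r hr
  rw [facetCount_twoCones_of_notMem hbB hbB.antipode hn h h', hpB.facetCount_boundary hr,
    ← hpB.boundary_antipode, hpB.antipode.facetCount_boundary hr]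
  split_ifs <;> omega

/-- The boundary of a ball that arises from the complement of `B` in `F` and from `-B` contains
the complex that arises from `F` by exchanging `±B`. -/
theorem exchange_subset_boundary (hF : IsPure F (c + 1) N) (hcl : IsClosed F c) (hBF : B ⊆ F)
    (hB : antipode B ⊆ F \ B) (hn : N < n) :
    exchange F B n ⊆ boundary (twoCones (F \ B) (antipode B) n) := by
  have hpB := hF.mono hBF
  have hpS := hF.mono (Finset.sdiff_subset (s := F) (t := B))
  have hsd : F \ (B ∪ antipode B) = (F \ B) \ antipode B := by
    ext; simp [not_or, and_assoc]
  rw [exchange_eq hpB, hsd]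
  refine Finset.union_subset (sdiff_subset_boundary_twoCones hpS hpB.antipode hn hB) ?_
  rw [← boundary_sdiff hF hcl hBF]
  have h := twoCones_boundary_subset hpS hpB.antipode hn
  rwa [hpB.boundary_antipode, ← boundary_sdiff hF hcl hBF] at h

/-! ### The cross-polytope -/

theorem crossPolytope_succ (m : ℕ) :
    crossPolytope (m + 1) = twoCones (crossPolytope m) (crossPolytope m) (m + 1) := by
  simp [crossPolytope, twoCones]

theorem isPure_crossPolytope (m : ℕ) : IsPure (crossPolytope m) m m := by
  induction m with
  | zero => intro σ hσ; simp_all [crossPolytope]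
  | succ m ih => rw [crossPolytope_succ]; exact isPure_twoCones ih ih m.lt_succ_self

theorem antipode_crossPolytope (m : ℕ) : antipode (crossPolytope m) = crossPolytope m := by
  induction m with
  | zero => simp [crossPolytope, antipode]
  | succ m ih => rw [crossPolytope_succ, antipode_twoCones, ih]

theorem isClosed_crossPolytope (m : ℕ) : IsClosed (crossPolytope (m + 1)) m := by
  induction m with
  | zero =>
    intro r hr
    obtain rfl := Finset.card_eq_zero.1 hr
    decide
  | succ m ih =>
    intro r hr
    have hp := isPure_crossPolytope (m + 1)
    rw [crossPolytope_succ (m + 1)]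
    by_cases h : ((m + 1 + 1 : ℕ) : ℤ) ∈ r
    · rw [facetCount_twoCones_of_mem hp hp (by omega) h]
      exact ih _ (card_erase_of_mem hr h)
    by_cases h' : -((m + 1 + 1 : ℕ) : ℤ) ∈ r
    · rw [facetCount_twoCones_of_neg_mem hp hp (by omega) h']
      exact ih _ (card_erase_of_mem hr h')
    rw [facetCount_twoCones_of_notMem hp hp (by omega) h h', hp.facetCount_eq_ite hr]
    split_ifs <;> omega

/-! ### The balls `B^{d,i}_n` and the spheres `Δ^d_n` -/

/-- The balls `B^{d,i}_n`, extended by the point `-1` for `d = 0`. -/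
def ballExt : ℕ → ℕ → ℕ → Finset (Finset ℤ)
  | 0 => fun _ _ => {{-1}}
  | d + 1 => ball (d + 1)

/-- The ball `B^{d,i-1}_n`, which is empty for `i = 0`. -/
def prevBall (d : ℕ) : ℕ → ℕ → Finset (Finset ℤ)
  | 0 => fun _ => ∅
  | i + 1 => ballExt d i

/-- With the point -1 in dimension 0, the edge {-1, n} also obeys the cone recursion, so all balls
but the complementary ones have one form. -/
theorem ballExt_succ (d i n : ℕ) (hi : i ≤ (d + 2) / 2) (hne : d + 2 ≠ 2 * i) :
    ballExt (d + 1) i n =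
      twoCones (ballExt d i (n - 1)) (antipode (prevBall d i (n - 1))) n := by
  rcases d with _ | d
  · obtain rfl : i = 0 := by omega
    simp [ballExt, prevBall, ball_one_zero, twoCones, cone, antipode, Finset.pair_comm]
  · rcases i with _ | i
    · simp [ballExt, prevBall, ball_zero, twoCones, cone, antipode]
    · simp only [ballExt, prevBall]
      rw [ball_succ (d + 1) i n (by omega) (by omega)]
      rfl

theorem ballExt_complement (k n : ℕ) :
    ballExt (2 * k + 1) (k + 1) n = sphereFacets (2 * k + 1) n \ ballExt (2 * k + 1) k n :=
  ball_complement k n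

theorem sphereFacets_succ_eq (d n : ℕ) (h : d + 2 ≤ n) :
    sphereFacets (d + 1) (n + 1) =
      exchange (sphereFacets (d + 1) n) (ballExt (d + 1) (d / 2) n) (n + 1) := by
  rw [sphereFacets_succ (d + 1) n h]
  have : (d + 1 + 1) / 2 - 1 = d / 2 := by omega
  rw [this]
  rfl

/-- The inductive properties of the spheres `Δ^d_n`. -/
structure SphereProperties (d n : ℕ) : Prop where
  isPure : IsPure (sphereFacets d n) (d + 1) n
  symm : antipode (sphereFacets d n) = sphereFacets d n
  isClosed : IsClosed (sphereFacets d n) d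
  ball_subset : ∀ i, i + 1 ≤ (d + 1) / 2 → ballExt d i n ⊆ sphereFacets d n

/-- The inductive properties of the balls `B^{d,i}_n`. -/
structure BallProperties (d i n : ℕ) : Prop where
  isPure : IsPure (ballExt d i n) (d + 1) n
  disjoint_prev : Disjoint (prevBall d i n) (ballExt d i n)
  antipode_prev_subset : antipode (prevBall d i n) ⊆ ballExt d i n
  subset_of_add_two : ∀ j, j + 2 = i → ballExt d j n ⊆ ballExt d i n
  subset_crossPolytope : n = d + 1 → ballExt d i n ⊆ crossPolytope (d + 1)
  facetCount_le : ∀ r : Finset ℤ, r.card = d → facetCount (ballExt d i n) r ≤ 2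
  isClosed_boundary : ∀ c, c + 1 = d → IsClosed (boundary (ballExt d i n)) c
  subset_boundary : ∀ e j, e + 1 = d → j ≤ i → j ≤ (e + 1) / 2 →
    ballExt e j n ⊆ boundary (ballExt d i n)

/-- The inductive properties of balls and spheres in dimension `d`. -/
structure DimensionProperties (d : ℕ) : Prop where
  ball : ∀ i n, i ≤ (d + 1) / 2 → d + 1 ≤ n → BallProperties d i n
  sphere : ∀ n, 1 ≤ d → d + 1 ≤ n → SphereProperties d n

variable {d i : ℕ}

theorem DimensionProperties.isPure_prev (h : DimensionProperties d) (hi : i ≤ (d + 1) / 2 + 1)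
    (hn : d + 1 ≤ n) : IsPure (prevBall d i n) (d + 1) n := by
  rcases i with _ | i
  · exact isPure_empty
  · exact (h.ball i n (by omega) hn).isPure

/-- The sphere `Δ^d_n` lies in the boundary of the ball `B^{d+1,(d+1)/2}_n` for odd `d`. -/
theorem DimensionProperties.sphere_subset_boundary {k : ℕ}
    (h : DimensionProperties (2 * k + 1)) (hn : 2 * k + 3 ≤ n) :
    sphereFacets (2 * k + 1) n ⊆ boundary (ballExt (2 * k + 2) (k + 1) n) := by
  obtain ⟨m, rfl⟩ := Nat.exists_eq_add_of_le' (show 1 ≤ n by omega)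
  have hS := h.sphere m (by omega) (by omega)
  have hsub := hS.ball_subset k (by omega)
  have h1 := (h.ball (k + 1) m (by omega) (by omega)).antipode_prev_subset
  simp only [prevBall, ballExt_complement] at h1
  -- With B = B^{2k+1,k}_m, the sphere is Δ_m with `±B` exchanged, while the ball consists of the
  -- cones over Δ_m \ B and -B.
  rw [sphereFacets_succ_eq (2 * k) m (by omega), ballExt_succ (2 * k + 1) (k + 1) (m + 1)
    (by omega) (by omega), ballExt_complement, Nat.add_sub_cancel]
  have h2 : 2 * k / 2 = k := by omega
  rw [h2]
  exact exchange_subset_boundary hS.isPure hS.isClosed hsub h1 m.lt_succ_self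

theorem dimensionProperties_zero : DimensionProperties 0 where
  ball i n hi hn := by
    obtain rfl : i = 0 := by omega
    refine ⟨?_, ?_, ?_, ?_, ?_, ?_, ?_, ?_⟩
    · intro σ hσ
      obtain rfl := Finset.mem_singleton.1 hσ
      simpa using hn
    · exact Finset.disjoint_empty_left _
    · simp [prevBall, antipode]
    · intro j hj; omega
    · intro _; simp only [ballExt]; decide
    · intro r _
      exact (Finset.card_filter_le _ _).trans (by simp [ballExt])
    · intro c hc; omega
    · intro e j he; omega
  sphere n h := by omega

/-- The balls other than `B^{2k-1,k}_n`. -/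
theorem DimensionProperties.ballProperties_succ (h : DimensionProperties d)
    (hi : i ≤ (d + 2) / 2) (hne : d + 2 ≠ 2 * i) (hn : d + 2 ≤ n) :
    BallProperties (d + 1) i n := by
  obtain ⟨m, rfl⟩ := Nat.exists_eq_add_of_le' (show 1 ≤ n by omega)
  have hm : d + 1 ≤ m := by omega
  have hlt : m < m + 1 := m.lt_succ_self
  have hi' : i ≤ (d + 1) / 2 := by omega
  have hX := h.ball i m hi' hm
  have hY := h.isPure_prev (i := i) (by omega) hm
  have hYA := hY.antipode
  have eq : ∀ j, j ≤ i → ballExt (d + 1) j (m + 1) =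
      twoCones (ballExt d j m) (antipode (prevBall d j m)) (m + 1) := fun j hj => by
    rw [ballExt_succ d j (m + 1) (by omega) (by omega), Nat.add_sub_cancel]
  have eqi := eq i le_rfl
  refine ⟨?_, ?_, ?_, ?_, ?_, ?_, ?_, ?_⟩
  · rw [eqi]; exact isPure_twoCones hX.isPure hYA hlt
  · rcases i with _ | i
    · exact Finset.disjoint_empty_left _
    · simp only [prevBall]
      rw [eqi, eq i (by omega)]
      have hX' := h.ball i m (by omega) hm
      have hY' := h.isPure_prev (i := i) (by omega) hm
      exact disjoint_twoCones hX'.isPure hY'.antipode hX.isPure hYA hlt hX.disjoint_prev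
        (disjoint_antipode hX'.disjoint_prev)
  · rcases i with _ | i
    · simp [prevBall, antipode]
    · simp only [prevBall]
      rw [eqi, eq i (by omega), antipode_twoCones, antipode_antipode]
      -- The antipode interchanges the two cones: the bases over `-n` agree, and over `n` the
      -- superscripts differ by two.
      refine twoCones_mono ?_ subset_rfl _
      rcases i with _ | i
      · exact Finset.empty_subset _
      · exact hX.subset_of_add_two i rfl
  · rintro j rfl
    rw [eqi, eq j (by omega)]
    refine twoCones_mono (hX.subset_of_add_two j rfl) (antipode_mono ?_) _
    rcases j with _ | j
    · exact Finset.empty_subset _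
    · exact (h.ball (j + 1 + 1) m (by omega) hm).subset_of_add_two j rfl
  · intro hmd
    have hmd' : m = d + 1 := by omega
    rw [eqi, crossPolytope_succ (d + 1), hmd']
    rw [hmd'] at hX
    refine twoCones_mono (hX.subset_crossPolytope rfl) ?_ _
    rw [← antipode_crossPolytope]
    refine antipode_mono ?_
    rcases i with _ | i
    · exact Finset.empty_subset _
    · exact (h.ball i (d + 1) (by omega) le_rfl).subset_crossPolytope rfl
  · intro r hr
    rw [eqi]
    refine facetCount_twoCones_le hX.isPure hYA hlt hX.facetCount_le ?_ hr
    intro r hr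
    rw [facetCount_antipode]
    rcases i with _ | i
    · simp [prevBall, facetCount_empty]
    · exact (h.ball i m (by omega) hm).facetCount_le _ (by rw [card_opposite, hr])
  · intro c hc
    obtain rfl : c = d := by omega
    rw [eqi]
    refine isClosed_boundary_twoCones hX.isPure hYA hlt hX.antipode_prev_subset hX.facetCount_le
      hX.isClosed_boundary fun b hb => ?_
    rw [hY.boundary_antipode]
    refine isClosed_antipode ?_
    rcases i with _ | i
    · intro r _; exact Or.inl rfl
    · exact (h.ball i m (by omega) hm).isClosed_boundary b hb
  · intro e j he hj hje
    obtain rfl : e = d := by omega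
    rcases e with _ | e
    · obtain rfl : i = 0 := by omega
      rw [eqi]
      intro r hr
      obtain rfl := Finset.mem_singleton.1 hr
      exact sdiff_subset_boundary_twoCones hX.isPure hYA hlt hX.antipode_prev_subset
        (by simp [ballExt, prevBall, antipode])
    -- If equality holds, the smaller ball is a complementary one, which lies in its sphere and
    -- hence in the boundary. Otherwise both balls are pairs of cones and the inclusion is inherited
    -- from their bases.
    · by_cases hje' : e + 2 = 2 * j
      · obtain ⟨k, rfl⟩ : ∃ k, e = 2 * k := ⟨j - 1, by omega⟩
        obtain rfl : j = k + 1 := by omega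
        obtain rfl : i = k + 1 := by omega
        rw [ballExt_complement]
        exact Finset.sdiff_subset.trans (h.sphere_subset_boundary (by omega))
      · rw [eqi, ballExt_succ e j (m + 1) (by omega) hje', Nat.add_sub_cancel]
        refine subset_trans (twoCones_mono (hX.subset_boundary e j rfl hj (by omega)) ?_ _)
          (twoCones_boundary_subset hX.isPure hYA hlt)
        rw [hY.boundary_antipode]
        refine antipode_mono ?_
        rcases j with _ | j
        · exact Finset.empty_subset _
        · obtain ⟨i, rfl⟩ : ∃ i', i = i' + 1 := ⟨i - 1, by omega⟩
          exact (h.ball i m (by omega) hm).subset_boundary e j rfl (by omega) (by omega)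

/-- The sphere `Δ^{d+1}_n`. -/
theorem DimensionProperties.sphereProperties_succ (h : DimensionProperties d)
    (hn : d + 2 ≤ n) : SphereProperties (d + 1) n := by
  induction n, hn using Nat.le_induction with
  | base =>
    have hbase := sphereFacets_base (d + 1)
    refine ⟨?_, ?_, ?_, fun i hi => ?_⟩ <;> rw [hbase]
    · exact isPure_crossPolytope _
    · exact antipode_crossPolytope _
    · exact isClosed_crossPolytope _
    · exact (h.ballProperties_succ (by omega) (by omega) le_rfl).subset_crossPolytope rfl
  | succ m hm ih =>
    have hB := h.ballProperties_succ (i := d / 2) (n := m) (by omega) (by omega) hm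
    have hsub := ih.ball_subset (d / 2) (by omega)
    have heq := sphereFacets_succ_eq d m hm
    -- The antipode interchanges the cones, so this reduces to disjointness of consecutive balls one
    -- dimension lower.
    have hdisj : Disjoint (ballExt (d + 1) (d / 2) m) (antipode (ballExt (d + 1) (d / 2) m)) := by
      have h1 := h.ball (d / 2) (m - 1) (by omega) (by omega)
      have h2 := h.isPure_prev (i := d / 2) (n := m - 1) (by omega) (by omega)
      rw [ballExt_succ d (d / 2) m (by omega) (by omega), antipode_twoCones, antipode_antipode]
      exact disjoint_twoCones h1.isPure h2.antipode h2 h1.isPure.antipode (by omega)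
        h1.disjoint_prev.symm (disjoint_antipode h1.disjoint_prev)
    refine ⟨?_, ?_, ?_, fun i hi => ?_⟩ <;> rw [heq]
    · exact isPure_exchange ih.isPure hB.isPure m.lt_succ_self
    · exact antipode_exchange ih.symm hB.isPure _
    · exact isClosed_exchange ih.isPure ih.symm ih.isClosed hsub hdisj hB.isClosed_boundary
        m.lt_succ_self
    · rw [ballExt_succ d i (m + 1) (by omega) (by omega), exchange_eq hB.isPure,
        Nat.add_sub_cancel]
      -- The ball already lies in the newly added cones, as their bases contain the balls of
      -- dimension `d`.
      refine subset_trans (twoCones_mono (hB.subset_boundary d i rfl (by omega) (by omega))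
        (antipode_mono ?_) _) Finset.subset_union_right
      rcases i with _ | i
      · exact Finset.empty_subset _
      · exact hB.subset_boundary d i rfl (by omega) (by omega)

/-- The complementary ball `B^{2k+1,k+1}_n`. -/
theorem DimensionProperties.ballProperties_complement {k : ℕ} (h : DimensionProperties (2 * k))
    (hn : 2 * k + 2 ≤ n) : BallProperties (2 * k + 1) (k + 1) n := by
  have hS := h.sphereProperties_succ hn
  have hB := h.ballProperties_succ (i := k) (by omega) (by omega) hn
  have hsub := hS.ball_subset k (by omega)
  have heq := ballExt_complement k n
  have hbd : boundary (ballExt (2 * k + 1) (k + 1) n) = boundary (ballExt (2 * k + 1) k n) := by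
    rw [heq, boundary_sdiff hS.isPure hS.isClosed hsub]
  refine ⟨?_, ?_, ?_, ?_, ?_, ?_, ?_, ?_⟩
  · rw [heq]; exact hS.isPure.mono Finset.sdiff_subset
  · rw [heq]; exact Finset.disjoint_sdiff
  · rw [heq, Finset.subset_sdiff]
    simp only [prevBall]
    refine ⟨by rw [← hS.symm]; exact antipode_mono hsub, ?_⟩
    have h1 := h.ball k (n - 1) (by omega) (by omega)
    have h2 := h.isPure_prev (i := k) (n := n - 1) (by omega) (by omega)
    rw [ballExt_succ (2 * k) k n (by omega) (by omega), antipode_twoCones, antipode_antipode]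
    exact disjoint_twoCones h2 h1.isPure.antipode h1.isPure h2.antipode (by omega)
      h1.disjoint_prev (disjoint_antipode h1.disjoint_prev.symm)
  · intro j hj
    obtain rfl : k = j + 1 := by omega
    rw [heq, Finset.subset_sdiff]
    exact ⟨hS.ball_subset j (by omega), hB.disjoint_prev⟩
  · rintro rfl
    rw [heq, ← sphereFacets_base]
    exact Finset.sdiff_subset
  · intro r hr
    have h1 := facetCount_mono (Finset.sdiff_subset (s := sphereFacets (2 * k + 1) n)
      (t := ballExt (2 * k + 1) k n)) r
    have h2 := hS.isClosed r hr
    rw [heq]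
    omega
  · rw [hbd]; exact hB.isClosed_boundary
  · intro e j he hj hje
    rw [hbd]
    exact hB.subset_boundary e j he (by omega) hje

theorem dimensionProperties (d : ℕ) : DimensionProperties d := by
  induction d with
  | zero => exact dimensionProperties_zero
  | succ d h =>
    refine ⟨fun i n hi hn => ?_, fun n _ hn => h.sphereProperties_succ hn⟩
    by_cases hne : d + 2 = 2 * i
    · obtain ⟨k, rfl⟩ : ∃ k, d = 2 * k := ⟨i - 1, by omega⟩
      obtain rfl : i = k + 1 := by omega
      exact h.ballProperties_complement hn
    · exact h.ballProperties_succ hi hne hn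

/-! ### Links and the main theorem -/

theorem insert_mem_boundary_ballExt {d j m : ℕ} (hj : j ≤ (d + 1) / 2) (hm : d + 1 ≤ m)
    {s : Finset ℤ} (hs : s ∈ boundary (ballExt d j m)) :
    insert ((m + 1 : ℕ) : ℤ) s ∈ boundary (ballExt (d + 1) j (m + 1)) := by
  have h := dimensionProperties d
  rw [ballExt_succ d j (m + 1) (by omega) (by omega), Nat.add_sub_cancel]
  exact twoCones_boundary_subset (h.ball j m hj hm).isPure
    (h.isPure_prev (by omega) hm).antipode m.lt_succ_self
    (Finset.mem_union_left _ (mem_cone_of_mem hs))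

theorem insert_mem_sphereFacets {d m : ℕ} (hm : d + 2 ≤ m) {s : Finset ℤ}
    (hs : s ∈ boundary (ballExt (d + 1) (d / 2) m)) :
    insert ((m + 1 : ℕ) : ℤ) s ∈ sphereFacets (d + 1) (m + 1) := by
  have h := (dimensionProperties (d + 1)).ball (d / 2) m (by omega) hm
  rw [sphereFacets_succ_eq d m hm, exchange_eq h.isPure]
  exact Finset.mem_union_right _ (Finset.mem_union_left _ (mem_cone_of_mem hs))

/-- The link of `{m + 1, m + 2}` in `Δ^{2k+3}_{m+2}` contains `Δ^{2k+1}_m`. -/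
theorem insert_two_mem_sphereFacets {k m : ℕ} (hm : 2 * k + 3 ≤ m) {s : Finset ℤ}
    (hs : s ∈ sphereFacets (2 * k + 1) m) :
    insert ((m + 2 : ℕ) : ℤ) (insert ((m + 1 : ℕ) : ℤ) s) ∈ sphereFacets (2 * k + 3) (m + 2) := by
  -- Coning with `m + 1` keeps the superscript `k + 1`, which is the one of the ball exchanged in
  -- Δ^{2k+3}_{m+1}.
  have h1 := (dimensionProperties (2 * k + 1)).sphere_subset_boundary hm hs
  have h2 := insert_mem_boundary_ballExt (by omega) (by omega) h1
  refine insert_mem_sphereFacets (d := 2 * k + 2) (m := m + 1) (by omega) ?_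
  rwa [show (2 * k + 2) / 2 = k + 1 by omega]

/-- The link of `{m + 1, m + 2, m + 3}` in `Δ^{2k+4}_{m+3}` contains `Δ^{2k+1}_m`. -/
theorem insert_three_mem_sphereFacets {k m : ℕ} (hm : 2 * k + 3 ≤ m) {s : Finset ℤ}
    (hs : s ∈ sphereFacets (2 * k + 1) m) :
    insert ((m + 3 : ℕ) : ℤ) (insert ((m + 2 : ℕ) : ℤ) (insert ((m + 1 : ℕ) : ℤ) s)) ∈
      sphereFacets (2 * k + 4) (m + 3) := by
  have h1 := (dimensionProperties (2 * k + 1)).sphere_subset_boundary hm hs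
  have h2 := insert_mem_boundary_ballExt (by omega) (by omega) h1
  have h3 := insert_mem_boundary_ballExt (by omega) (by omega) h2
  refine insert_mem_sphereFacets (d := 2 * k + 3) (m := m + 2) (by omega) ?_
  rwa [show (2 * k + 3) / 2 = k + 1 by omega]

/-- `τ` is a face of `Δ^d_n` with vertices larger than `m` whose link contains `Δ^3_m`. -/
structure IsLinkFace (τ : List ℤ) (m d n : ℕ) : Prop where
  length : τ.length + 3 = d
  nodup : τ.Nodup
  lt : ∀ v ∈ τ, m < v.natAbs
  le : ∀ v ∈ τ, v.natAbs ≤ n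
  mem : ∀ f ∈ sphereFacets 3 m, τ.toFinset ∪ f ∈ sphereFacets d n

/-- Each step lowers `d` and `n` by two, so n ≥ d + 2 persists down to d = 3, where n ≥ 5. -/
theorem exists_isLinkFace_odd (k : ℕ) : ∀ n, 2 * k + 5 ≤ n →
    ∃ τ m, 5 ≤ m ∧ m ≤ n ∧ IsLinkFace τ m (2 * k + 3) n := by
  induction k with
  | zero =>
    intro n hn
    exact ⟨[], n, by omega, le_rfl, by simp, by simp, by simp, by simp, by simp⟩
  | succ k ih =>
    intro n hn
    obtain ⟨n, rfl⟩ := Nat.exists_eq_add_of_le' (show 2 ≤ n by omega)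
    obtain ⟨τ, m, hm, hmn, h⟩ := ih n (by omega)
    have hlarge : ∀ a : ℕ, n < a → (a : ℤ) ∉ τ := fun a ha hmem => by
      have := h.le _ hmem
      simp at this
      omega
    refine ⟨((n + 2 : ℕ) : ℤ) :: ((n + 1 : ℕ) : ℤ) :: τ, m, hm, by omega, ?_, ?_, ?_, ?_, ?_⟩
    · have := h.length
      simp only [List.length_cons]
      omega
    · simp only [List.nodup_cons, List.mem_cons, not_or]
      exact ⟨⟨by omega, hlarge _ (by omega)⟩, hlarge _ (by omega), h.nodup⟩
    · simp only [List.forall_mem_cons]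
      exact ⟨by simp; omega, by simp; omega, h.lt⟩
    · simp only [List.forall_mem_cons]
      exact ⟨by omega, by omega, fun v hv => (h.le v hv).trans (by omega)⟩
    · intro f hf
      have := insert_two_mem_sphereFacets (k := k + 1) (by omega) (h.mem f hf)
      simpa [Finset.insert_union] using this

theorem exists_isLinkFace_even (k n : ℕ) (hn : 2 * k + 8 ≤ n) :
    ∃ τ m, 5 ≤ m ∧ IsLinkFace τ m (2 * k + 6) n := by
  obtain ⟨n, rfl⟩ := Nat.exists_eq_add_of_le' (show 3 ≤ n by omega)
  obtain ⟨τ, m, hm, hmn, h⟩ := exists_isLinkFace_odd k n (by omega)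
  have hlarge : ∀ a : ℕ, n < a → (a : ℤ) ∉ τ := fun a ha hmem => by
    have := h.le _ hmem
    simp at this
    omega
  refine ⟨((n + 3 : ℕ) : ℤ) :: ((n + 2 : ℕ) : ℤ) :: ((n + 1 : ℕ) : ℤ) :: τ, m, hm,
    ?_, ?_, ?_, ?_, ?_⟩
  · have := h.length
    simp only [List.length_cons]
    omega
  · simp only [List.nodup_cons, List.mem_cons, not_or]
    exact ⟨⟨by omega, by omega, hlarge _ (by omega)⟩, ⟨by omega, hlarge _ (by omega)⟩,
      hlarge _ (by omega), h.nodup⟩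
  · simp only [List.forall_mem_cons]
    exact ⟨by simp; omega, by simp; omega, by simp; omega, h.lt⟩
  · simp only [List.forall_mem_cons]
    exact ⟨by omega, by omega, by omega, fun v hv => (h.le v hv).trans (by omega)⟩
  · intro f hf
    have := insert_three_mem_sphereFacets (k := k + 1) (by omega) (h.mem f hf)
    rw [show 2 * (k + 1) + 4 = 2 * k + 6 by ring] at this
    simpa [Finset.insert_union] using this

/-- Facets of `Δ^d_m` survive an exchange unless they lie in one of the two balls. -/
theorem mem_sphereFacets_succ {d m : ℕ} (hm : d + 2 ≤ m) {f : Finset ℤ}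
    (hf : f ∈ sphereFacets (d + 1) m) (h1 : f ∉ ballExt (d + 1) (d / 2) m)
    (h2 : f ∉ antipode (ballExt (d + 1) (d / 2) m)) : f ∈ sphereFacets (d + 1) (m + 1) := by
  rw [sphereFacets_succ_eq d m hm, exchange]
  refine Finset.mem_union_left _ (Finset.mem_sdiff.2 ⟨hf, ?_⟩)
  rw [Finset.mem_union, not_or]
  exact ⟨h1, h2⟩

theorem mem_of_mem_ballExt {d i n : ℕ} (hi : i ≤ (d + 2) / 2) (hne : d + 2 ≠ 2 * i)
    {f : Finset ℤ} (hf : f ∈ ballExt (d + 1) i n) : (n : ℤ) ∈ f ∨ -(n : ℤ) ∈ f := by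
  rw [ballExt_succ d i n hi hne] at hf
  rcases Finset.mem_union.1 hf with hf | hf
  · obtain ⟨x, -, rfl⟩ := Finset.mem_image.1 hf
    exact Or.inl (Finset.mem_insert_self _ _)
  · obtain ⟨x, -, rfl⟩ := Finset.mem_image.1 hf
    exact Or.inr (Finset.mem_insert_self _ _)

/-- A facet of `Δ^d_n` without the vertices `±n` is a facet of all later spheres. -/
theorem mem_sphereFacets_of_le {d n m : ℕ} (hn : d + 2 ≤ n) (hnm : n ≤ m) {f : Finset ℤ}
    (hf : f ∈ sphereFacets (d + 1) n) (hv : ∀ v ∈ f, v.natAbs < n) :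
    f ∈ sphereFacets (d + 1) m := by
  induction m, hnm using Nat.le_induction with
  | base => exact hf
  | succ m hnm ih =>
    refine mem_sphereFacets_succ (by omega) ih (fun h => ?_) (fun h => ?_)
    · rcases mem_of_mem_ballExt (by omega) (by omega) h with h | h <;>
      · have := hv _ h
        simp at this
        omega
    · rw [mem_antipode] at h
      rcases mem_of_mem_ballExt (by omega) (by omega) h with h | h <;>
      · have := hv _ (mem_opposite.1 h)
        simp at this
        omega

/-- Only the exchange at `n` needs checking: the balls exchanged afterwards consist of facets
through vertices of absolute value above `n`. -/
theorem mem_sphereFacets_of_survives {d n m : ℕ} (hn : d + 2 ≤ n) (hnm : n ≤ m) {f : Finset ℤ}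
    (hf : f ∈ sphereFacets (d + 1) n ∧ f ∉ ballExt (d + 1) (d / 2) n ∧
      f ∉ antipode (ballExt (d + 1) (d / 2) n)) : f ∈ sphereFacets (d + 1) m := by
  rcases hnm.eq_or_lt with rfl | hnm
  · exact hf.1
  · refine mem_sphereFacets_of_le (n := n + 1) (by omega) hnm
      (mem_sphereFacets_succ hn hf.1 hf.2.1 hf.2.2) fun v hv => Nat.lt_succ_of_le ?_
    exact (((dimensionProperties (d + 1)).sphere n (by omega) hn).isPure _ hf.1).2 v hv

set_option maxRecDepth 100000 in
theorem facetsUsed_survive_three : ∀ f ∈ facetsUsed (refutationSame ++ refutationOpposite),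
    f.toFinset ∈ sphereFacets 3 5 ∧ f.toFinset ∉ ballExt 3 1 5 ∧
      f.toFinset ∉ antipode (ballExt 3 1 5) := by
  decide +kernel

set_option maxRecDepth 100000 in
theorem facetsUsed_survive_four : ∀ f ∈ facetsUsed refutationFour,
    f.toFinset ∈ sphereFacets 4 6 ∧ f.toFinset ∉ ballExt 4 1 6 ∧
      f.toFinset ∉ antipode (ballExt 4 1 6) := by
  decide +kernel

/-- The chirotope of the link of a face of a realizable complex. -/
theorem exists_isChirotope_of_isRealizable {F : Finset (Finset ℤ)} {D k : ℕ}
    (h : IsRealizable (complexOf F) D) (τ : List ℤ) (hτ : τ.Nodup) (hk2 : 2 ≤ k)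
    (hk : τ.length + k = D + 1)
    (L : List (List ℤ)) (V : List ℤ) (hL : ∀ f ∈ L, f.length + 1 = k ∧ f.Nodup ∧ ∀ v ∈ f, v ∈ V)
    (hF : ∀ f ∈ L, τ.toFinset ∪ f.toFinset ∈ F) (hV : ∀ v ∈ V, ∃ f ∈ L, v ∈ f)
    (hVτ : ∀ v ∈ V, v ∉ τ) :
    ∃ χ : List ℤ → ℝ, IsChirotope χ k ∧ ∀ f ∈ L, IsSupporting χ V f := by
  obtain ⟨χ, hχ, hsup⟩ := h.exists_isChirotope τ hk
  refine ⟨χ, hχ, fun f hf => ?_⟩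
  obtain ⟨hlen, hnd, hfV⟩ := hL f hf
  have hV' : ∀ v ∈ V, {v} ∈ (complexOf F).faces ∧ v ∉ τ := fun v hv => by
    obtain ⟨g, hg, hvg⟩ := hV v hv
    exact ⟨⟨Finset.singleton_nonempty v, _, hF g hg, by simp [hvg]⟩, hVτ v hv⟩
  refine hsup f V hlen (hτ.append hnd fun v hv hvf => hVτ v (hfV v hvf) hv) ?_ hV'
  rw [List.toFinset_append]
  refine ⟨?_, _, hF f hf, subset_rfl⟩
  obtain ⟨v, hv⟩ := List.exists_mem_of_length_pos (show 0 < f.length by omega)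
  exact ⟨v, by simp [hv]⟩

theorem not_isRealizable_of_isLinkFace {τ : List ℤ} {m d n : ℕ} (hm : 5 ≤ m)
    (h : IsLinkFace τ m d n) : ¬ IsRealizable (sphere d n) (d + 1) := by
  intro hreal
  have hlen := h.length
  obtain ⟨χ, hχ, hsup⟩ := exists_isChirotope_of_isRealizable (k := 5) hreal τ h.nodup (by omega)
    (by omega)
    (facetsUsed (refutationSame ++ refutationOpposite)) (vertexList 5) (by decide +kernel)
    (fun f hf => h.mem _ (mem_sphereFacets_of_survives (d := 2) (by omega) hm
      (facetsUsed_survive_three f hf))) (by decide +kernel) fun v hv hvτ => by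
        have h1 := h.lt v hvτ
        have h2 : ∀ v ∈ vertexList 5, v.natAbs ≤ 5 := by decide +kernel
        have := h2 v hv
        omega
  obtain ⟨f, hf, hnot⟩ := exists_not_isSupporting_three hχ
  exact hnot (hsup f hf)

theorem not_isRealizable_four {n : ℕ} (hn : 6 ≤ n) : ¬ IsRealizable (sphere 4 n) 5 := by
  intro hreal
  obtain ⟨χ, hχ, hsup⟩ := exists_isChirotope_of_isRealizable (k := 6) hreal [] List.nodup_nil (by omega)
    rfl
    (facetsUsed refutationFour) (vertexList 6) (by decide +kernel)
    (fun f hf => by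
      simpa using mem_sphereFacets_of_survives (d := 3) (by omega) hn
        (facetsUsed_survive_four f hf))
    (by decide +kernel) (by simp)
  obtain ⟨f, hf, hnot⟩ := exists_not_isSupporting_four hχ
  exact hnot (hsup f hf)

end NovikZheng

theorem mainTheorem3 (d n : ℕ) (hd : 3 ≤ d) (hn : d + 2 ≤ n) :
    ¬ NovikZheng.IsRealizable (NovikZheng.sphere d n) (d + 1) := by
  rcases Nat.even_or_odd' d with ⟨k, rfl | rfl⟩
  -- For d = 4 a link of three vertices would have dimension 1, too small for the certificate in
  -- Δ^3_5.
  · by_cases hk : k = 2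
    · subst hk
      exact NovikZheng.not_isRealizable_four hn
    · obtain ⟨j, rfl⟩ := Nat.exists_eq_add_of_le' (show 3 ≤ k by omega)
      obtain ⟨τ, m, hm, h⟩ := NovikZheng.exists_isLinkFace_even j n (by omega)
      exact NovikZheng.not_isRealizable_of_isLinkFace hm h
  · obtain ⟨j, rfl⟩ := Nat.exists_eq_add_of_le' (show 1 ≤ k by omega)
    obtain ⟨τ, m, hm, -, h⟩ := NovikZheng.exists_isLinkFace_odd j n (by omega)
    exact NovikZheng.not_isRealizable_of_isLinkFace hm h
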